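/- **Setting.** Let $Y=[0,1)^3$, $Y'=[-\pi,\pi)^3$, and let $H^1_\#=H^1_\#(Y;\mathbb C^3)$ be the closure of the smooth $\mathbb Z^3$-periodic functions $\mathbb R^3\to\mathbb C^3$ in the norm of $H^1(Y)$. For $a,b\in\mathbb C^3$ put $\langle a,b\rangle=\sum_i a_i\overline{b_i}$, and for $G,H\in\mathbb C^{3\times3}$ put $G:\overline H=\sum_{i,j}G_{ij}\overline{H_{ij}}$. Let $\mathbb A=(\mathbb A^{ik}_{jl})$ be a real $\mathbb Z^3$-periodic fourth-order tensor field on $\mathbb R^3$, acting by $(\mathbb A B)_{ij}=\sum_{k,l}\mathbb A^{ik}_{jl}B_{kl}$, with coefficients in $L^\infty(Y)$, with $\mathbb A^{ik}_{jl}=\mathbb A^{jk}_{il}=\mathbb A^{ki}_{lj}$, and such that for some $\nu>0$ one has $\nu|\xi|^2\le\mathbb A(y)\xi:\xi\le\nu^{-1}|\xi|^2$ for all $y\in Y$ and all real symmetric $\xi$. Let $\chi\in Y'\setminus\{0\}$ and $X_\chi u=\operatorname{sym}(u\chi^\top)$. Write $S=\operatorname{sym}\nabla$, $X=iX_\chi$,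 $E(G,H)=\int_Y\mathbb A G:\overline H$ and $(u,v)=\int_Y\langle u,v\rangle$. For $c\in\mathbb C^3$ let $u_c\in H^1_\#$ solve $E(Su_c+Xc,Sv)=0$ for all $v\in H^1_\#$, $\int_Yu_c=0$, and let $\mathcal A^{\hom}_\chi\in\mathbb C^{3\times3}$ be the matrix with $\langle\mathcal A_\chi^{\hom}c,d\rangle=E(Su_c+Xc,Xd)$ for all $c,d\in\mathbb C^3$. Let $\mathcal A_\chi$ be the operator on $L^2(Y;\mathbb C^3)$ of the form $a_\chi(u,v)=E((S+X)u,(S+X)v)$ with form domain $H^1_\#$. Let $z\in\rho(|\chi|^{-2}\mathcal A_\chi^{\hom})$. For $f\in L^2(Y;\mathbb C^3)$ the resolvent problem is to find $u\in H^1_\#$ with $$|\chi|^{-2}a_\chi(u,v)-z(u,v)=(f,v)\qquad\forall v\in H^1_\#.\tag{1}$$ **Asymptotic procedure.** At cycle $n\ge0$, insert $\sum_{k=0}^n(u_0^{(k)}+u_1^{(k)}+u_2^{(k)})$, with $u_j^{(k)}\in H^1_\#$, into (1) and expand. Count $u_j^{(k)}$ as of order $j+k$, each occurrence of $iX_\chi$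 (on the solution or on the test function) as of order $1$, the factor $|\chi|^{-2}$ as of order $-2$, and $f$, $z$, $v$ as of order $0$. The sums of all terms of orders $n-2$, $n-1$ and $n$ are each required to vanish for every $v\in H^1_\#$, and $\int_Yu_1^{(n)}=\int_Yu_2^{(n)}=0$. **Cycle problems.** For $g\in L^2(Y;\mathbb C^3)$ and $p,q,r\in H^1_\#$, the problem $\mathcal P(g;p,q,r)$ for $(u_0,u_1,u_2)\in(H^1_\#)^3$ is: for all $v\in H^1_\#$ and $v_0\in\mathbb C^3$, $$\begin{aligned}&E(Su_0,Sv)=0;\qquad E(Su_1,Sv)=-E(Xu_0,Sv),\quad \textstyle\int_Yu_1=0;\\ &E(Su_2,Sv)=-E(X(u_1+q),Sv)-E(S(u_1+q),Xv)-E(X(u_0+p+r),Xv)\\ &\qquad\qquad\quad+z|\chi|^2(u_0+p+r,v)+|\chi|^2(g,v),\qquad\textstyle\int_Yu_2=0;\\ &|\chi|^{-2}\langle\mathcal A_\chi^{\hom}u_0,v_0\rangle-z(u_0,v_0)=(g,v_0)-|\chi|^{-2}E(Sq+X(p+r),Xv_0),\end{aligned}$$ where in the last line the matrix $\mathcal A_\chi^{\hom}$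 acts on the vector $\int_Y u_0$ (the first equation makes $u_0$ constant). **Theorem.** 1. The cell problem for $u_c$ is uniquely solvable for every $c\in\mathbb C^3$, and the matrix $\mathcal A_\chi^{\hom}$ is well defined. 2. If $\int_Yp=\int_Yr=0$, then $\mathcal P(g;p,q,r)$ has exactly one solution, and $\|u_j\|_{H^1}\le C(\|g\|_{L^2}+\|p\|_{H^1}+\|q\|_{H^1}+\|r\|_{H^1})$ for $j=0,1,2$, with $C$ independent of $g,p,q,r$. 3. For every $f\in L^2(Y;\mathbb C^3)$ there is exactly one family $(u_j^{(n)})_{n\ge0,\,j=0,1,2}$ produced by the asymptotic procedure. Each $u_0^{(n)}$ is a constant vector. The triple $(u_0^{(n)},u_1^{(n)},u_2^{(n)})$ is the unique solution of $\mathcal P(f;0,0,0)$ if $n=0$, of $\mathcal P(0;u_1^{(0)},u_2^{(0)},0)$ if $n=1$, and of $\mathcal P(0;u_1^{(n-1)},u_2^{(n-1)},u_2^{(n-2)})$ if $n\ge2$. 4. If $z\in\rho(|\chi|^{-2}\mathcal A_\chi)$, then (1) has exactly one solution $u$ for every $f\in L^2(Y;\mathbb C^3)$. Whenever $u$ solves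 (1), the error $u_{\rm error}^{(n)}=u-\sum_{k=0}^n(u_0^{(k)}+u_1^{(k)}+u_2^{(k)})$ satisfies, for every $n\ge0$ and with $u_2^{(-1)}=0$, $$|\chi|^{-2}a_\chi(u_{\rm error}^{(n)},v)-z(u_{\rm error}^{(n)},v)=|\chi|^{-2}\mathcal R_{\rm error}^{(n)}(v)\qquad\forall v\in H^1_\#,$$ $$\begin{aligned}\mathcal R_{\rm error}^{(n)}(v)=&-E(Xu_2^{(n-1)},Xv)-E(Xu_1^{(n)},Xv)-E(Su_2^{(n)},Xv)-E(Xu_2^{(n)},Sv)-E(Xu_2^{(n)},Xv)\\&+z|\chi|^2(u_2^{(n-1)},v)+z|\chi|^2(u_1^{(n)},v)+z|\chi|^2(u_2^{(n)},v).\end{aligned}$$ -/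

import Mathlib

open MeasureTheory
open scoped ContDiff Matrix

noncomputable section

namespace Elasticity

/-- The space `ℂ³` with its Euclidean norm. -/
abbrev Vec : Type := EuclideanSpace ℂ (Fin 3)

/-- The space `ℂ^{3×3}` with the Frobenius norm; the entry in row `i`, column `j` is at `(i, j)`. -/
abbrev Mat : Type := EuclideanSpace ℂ (Fin 3 × Fin 3)

/-- The unit cell `Y = [0,1)³`. -/
def cell : Set (Fin 3 → ℝ) := Set.univ.pi fun _ => Set.Ico 0 1

/-- Lebesgue measure on `Y`. -/
abbrev cellMeasure : Measure (Fin 3 → ℝ) := volume.restrict cell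

/-- The dual cell `Y' = [-π,π)³`. -/
def dualCell : Set (EuclideanSpace ℝ (Fin 3)) :=
  {χ | ∀ i, χ i ∈ Set.Ico (-Real.pi) Real.pi}

/-! ### The coefficient tensor -/

/-- A field of real fourth-order tensors on `ℝ³`. The number `𝔸 y i j k l` is the coefficient
`𝔸^{ik}_{jl}(y)`, so that `(𝔸 B)_{ij} = ∑_{k,l} 𝔸 i j k l * B_{kl}`. -/
abbrev TensorField : Type := (Fin 3 → ℝ) → Fin 3 → Fin 3 → Fin 3 → Fin 3 → ℝ

/-- The assumptions on the tensor of material coefficients. -/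
structure IsElasticityTensor (𝔸 : TensorField) : Prop where
  periodic : ∀ y (a : Fin 3), 𝔸 (y + Pi.single a 1) = 𝔸 y
  elliptic : ∃ ν : ℝ, 0 < ν ∧ ∀ y ∈ cell, ∀ ξ : Matrix (Fin 3) (Fin 3) ℝ, ξ.IsSymm →
    ν * (∑ i, ∑ j, ξ i j ^ 2) ≤ ∑ i, ∑ j, ∑ k, ∑ l, 𝔸 y i j k l * ξ k l * ξ i j ∧
    ∑ i, ∑ j, ∑ k, ∑ l, 𝔸 y i j k l * ξ k l * ξ i j ≤ 1 / ν * (∑ i, ∑ j, ξ i j ^ 2)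
  symm_minor : ∀ y i j k l, 𝔸 y i j k l = 𝔸 y j i k l
  symm_major : ∀ y i j k l, 𝔸 y i j k l = 𝔸 y k l i j
  memLp_top : ∀ i j k l, MemLp (fun y => 𝔸 y i j k l) ⊤ cellMeasure

/-! ### Function spaces -/

/-- `L²(Y; ℂ³)`. -/
abbrev L2Vec : Type := Lp Vec 2 cellMeasure

/-- `L²(Y; ℂ^{3×3})`. -/
abbrev L2Mat : Type := Lp Mat 2 cellMeasure

/-- The gradient `(∇φ)_{ij} = ∂_j φ_i`. -/
def gradient (φ : (Fin 3 → ℝ) → Vec) (y : Fin 3 → ℝ) : Mat :=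
  WithLp.toLp 2 fun p => fderiv ℝ φ y (Pi.single p.2 1) p.1

/-- `φ` is a smooth `ℤ³`-periodic function on `ℝ³`. -/
def IsSmoothPeriodic (φ : (Fin 3 → ℝ) → Vec) : Prop :=
  ContDiff ℝ ∞ φ ∧ ∀ y (a : Fin 3), φ (y + Pi.single a 1) = φ y

/-- The pairs `(φ, ∇φ)` in `L²(Y; ℂ³) × L²(Y; ℂ^{3×3})`, with `φ` smooth and periodic. The norm of
the pair is the `H¹` norm `(‖φ‖² + ‖∇φ‖²)^{1/2}` of `φ`. -/
def smoothPeriodic : Submodule ℂ (WithLp 2 (L2Vec × L2Mat)) where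
  carrier := {w | ∃ φ, IsSmoothPeriodic φ ∧ w.fst =ᵐ[cellMeasure] φ ∧
    w.snd =ᵐ[cellMeasure] gradient φ}
  zero_mem' := by
    refine ⟨0, ⟨contDiff_const, fun _ _ => rfl⟩, Lp.coeFn_zero _ _ _, ?_⟩
    have h : gradient 0 = 0 := by
      funext y
      ext p
      simp [gradient]
    rw [h]
    exact Lp.coeFn_zero _ _ _
  add_mem' := by
    rintro a b ⟨φ, hφ, h1, h2⟩ ⟨ψ, hψ, h3, h4⟩
    refine ⟨φ + ψ, ⟨hφ.1.add hψ.1, fun y j => by simp [hφ.2, hψ.2]⟩, ?_, ?_⟩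
    · exact (Lp.coeFn_add a.fst b.fst).trans (h1.add h3)
    · have h : gradient (φ + ψ) = gradient φ + gradient ψ := by
        funext y
        ext p
        have hd := fderiv_add (𝕜 := ℝ) (hφ.1.differentiable (by simp) y)
          (hψ.1.differentiable (by simp) y)
        simp [gradient, hd]
      rw [h]
      exact (Lp.coeFn_add a.snd b.snd).trans (h2.add h4)
  smul_mem' := by
    rintro c a ⟨φ, hφ, h1, h2⟩
    refine ⟨c • φ, ⟨contDiff_const.smul hφ.1, fun y j => by simp [hφ.2]⟩, ?_, ?_⟩
    · exact (Lp.coeFn_smul c a.fst).trans (h1.const_smul c)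
    · have h : gradient (c • φ) = c • gradient φ := by
        funext y
        ext p
        have hd := fderiv_const_smul (𝕜 := ℝ) (hφ.1.differentiable (by simp) y) c
        simp [gradient, hd]
      rw [h]
      exact (Lp.coeFn_smul c a.snd).trans (h2.const_smul c)

/-- The periodic Sobolev space `H¹_#(Y; ℂ³)`: the closure of the smooth periodic functions in the
`H¹` norm. An element `w` is the pair of the function `w.1.fst` and its gradient `w.1.snd`. -/
abbrev H1per : Type := smoothPeriodic.topologicalClosure

/-- The function underlying an element of `H¹_#`. -/
def fn (w : H1per) : L2Vec := w.1.fst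

/-- The mean `∫_Y w`. -/
def mean (w : H1per) : Vec := ∫ y, fn w y ∂cellMeasure

/-! ### Strains, forms, and the fibre operator -/

/-- The symmetric part of a matrix. -/
def symPart (B : Mat) : Mat := WithLp.toLp 2 fun p => (B (p.1, p.2) + B (p.2, p.1)) / 2

/-- The symmetrized gradient `sym ∇ w`. -/
def symGrad (w : H1per) (y : Fin 3 → ℝ) : Mat := symPart (w.1.snd y)

/-- The matrix `i X_χ c = i sym (c χᵀ)`, for a vector `c`. -/
def iX (χ : EuclideanSpace ℝ (Fin 3)) (c : Vec) : Mat :=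
  Complex.I • symPart (WithLp.toLp 2 fun p => c p.1 * (χ p.2 : ℂ))

/-- The function `i X_χ w`. -/
def iXfn (χ : EuclideanSpace ℝ (Fin 3)) (w : H1per) (y : Fin 3 → ℝ) : Mat := iX χ (fn w y)

/-- `∫_Y 𝔸 G : conj H`. -/
def energy (𝔸 : TensorField) (G H : (Fin 3 → ℝ) → Mat) : ℂ :=
  ∫ y, ∑ i, ∑ j, ∑ k, ∑ l, (𝔸 y i j k l : ℂ) * G y (k, l) * star (H y (i, j)) ∂cellMeasure

/-- `∫_Y u · conj v`. -/
def mass (u v : (Fin 3 → ℝ) → Vec) : ℂ :=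
  ∫ y, ∑ i, u y i * star (v y i) ∂cellMeasure

/-- The form `a_χ(u,v) = ∫_Y 𝔸 (sym ∇ + i X_χ) u : conj ((sym ∇ + i X_χ) v)` on `H¹_#`. -/
def fiberForm (𝔸 : TensorField) (χ : EuclideanSpace ℝ (Fin 3)) (u v : H1per) : ℂ :=
  energy 𝔸 (symGrad u + iXfn χ u) (symGrad v + iXfn χ v)

/-- The graph in `L² × L²` of the operator `𝒜_χ` of the form `a_χ`. -/
def fiberOperatorGraph (𝔸 : TensorField) (χ : EuclideanSpace ℝ (Fin 3)) : Set (L2Vec × L2Vec) :=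
  {p | ∃ w : H1per, fn w = p.1 ∧ ∀ v : H1per, fiberForm 𝔸 χ w v = mass p.2 (fn v)}

/-- The resolvent set of `|χ|⁻² 𝒜_χ`: the operator `|χ|⁻² 𝒜_χ - z` is a bijection of its domain
onto `L²(Y; ℂ³)` whose inverse `R` is bounded. -/
def fiberResolventSet (𝔸 : TensorField) (χ : EuclideanSpace ℝ (Fin 3)) : Set ℂ :=
  {z | ∃ R : L2Vec →L[ℂ] L2Vec, ∀ f u : L2Vec, R f = u ↔
    ∃ g : L2Vec, (u, g) ∈ fiberOperatorGraph 𝔸 χ ∧ ((‖χ‖ : ℂ) ^ 2)⁻¹ • g - z • u = f}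

/-- `u` solves `|χ|⁻² a_χ(u,v) - z ∫ u · conj v = F(v)` for all `v` in `H¹_#`. -/
def SolvesResolventProblem (𝔸 : TensorField) (χ : EuclideanSpace ℝ (Fin 3)) (z : ℂ)
    (F : H1per → ℂ) (u : H1per) : Prop :=
  ∀ v : H1per, ((‖χ‖ : ℂ) ^ 2)⁻¹ * fiberForm 𝔸 χ u v - z * mass (fn u) (fn v) = F v

/-! ### The homogenized matrix -/

/-- The cell problem that defines the corrector `u_c`. -/
def IsCorrector (𝔸 : TensorField) (χ : EuclideanSpace ℝ (Fin 3)) (c : Vec) (w : H1per) : Prop :=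
  (∀ v : H1per, energy 𝔸 (symGrad w + fun _ => iX χ c) (symGrad v) = 0) ∧ mean w = 0

open Classical in
/-- The corrector `u_c`, the solution of its cell problem. -/
def corrector (𝔸 : TensorField) (χ : EuclideanSpace ℝ (Fin 3)) (c : Vec) : H1per :=
  if h : ∃ w, IsCorrector 𝔸 χ c w then h.choose else 0

/-- `∫_Y 𝔸 (sym ∇ u_c + i X_χ c) : conj (i X_χ d)`. -/
def homForm (𝔸 : TensorField) (χ : EuclideanSpace ℝ (Fin 3)) (c d : Vec) : ℂ :=
  energy 𝔸 (symGrad (corrector 𝔸 χ c) + fun _ => iX χ c) (fun _ => iX χ d)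

/-- The homogenized matrix `𝒜_χ^hom`, the matrix of the form `homForm`. -/
def homMatrix (𝔸 : TensorField) (χ : EuclideanSpace ℝ (Fin 3)) : Matrix (Fin 3) (Fin 3) ℂ :=
  Matrix.of fun i j => homForm 𝔸 χ (EuclideanSpace.single j 1) (EuclideanSpace.single i 1)

/-- `⟨𝒜_χ^hom c, d⟩`, with the inner product of `ℂ³` that is linear on the left. -/
def homPairing (𝔸 : TensorField) (χ : EuclideanSpace ℝ (Fin 3)) (c d : Vec) : ℂ :=
  ∑ i, (homMatrix 𝔸 χ *ᵥ WithLp.ofLp c) i * star (d i)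

/-! ### The asymptotic procedure -/

/-- The terms of order `m` among those that `w` contributes to the left-hand side of the resolvent
equation, tested with `v`, when `w` counts as a term of order `s`. Each `i X_χ` raises the order
by one, and the prefactor `|χ|⁻²` lowers it by two. -/
def orderTerms (𝔸 : TensorField) (χ : EuclideanSpace ℝ (Fin 3)) (z : ℂ) (m s : ℤ)
    (w v : H1per) : ℂ :=
  (if s - 2 = m then ((‖χ‖ : ℂ) ^ 2)⁻¹ * energy 𝔸 (symGrad w) (symGrad v) else 0) +
  (if s - 1 = m then ((‖χ‖ : ℂ) ^ 2)⁻¹ * (energy 𝔸 (symGrad w) (iXfn χ v) +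
      energy 𝔸 (iXfn χ w) (symGrad v)) else 0) +
  (if s = m then ((‖χ‖ : ℂ) ^ 2)⁻¹ * energy 𝔸 (iXfn χ w) (iXfn χ v) - z * mass (fn w) (fn v)
      else 0)

/-- All the terms of order `m` (left-hand side minus right-hand side) of the resolvent equation for
the expansion `∑_{k ≤ n} (u_0^{(k)} + u_1^{(k)} + u_2^{(k)})`, where `u_j^{(k)}`, written `u k j`,
counts as a term of order `j + k`. -/
def collect (𝔸 : TensorField) (χ : EuclideanSpace ℝ (Fin 3)) (z : ℂ) (f : L2Vec)
    (u : ℕ → Fin 3 → H1per) (n : ℕ) (m : ℤ) (v : H1per) : ℂ :=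
  (∑ k ∈ Finset.range (n + 1), ∑ j : Fin 3,
    orderTerms 𝔸 χ z m ((j : ℕ) + (k : ℤ)) (u k j) v) - (if m = 0 then mass f (fn v) else 0)

/-- `u` is produced by the asymptotic procedure: at every cycle `n` the terms of orders `n - 2`,
`n - 1` and `n` are equated to zero. (Cancelling the equations of the earlier cycles first subtracts
zero and does not change these equations.) The terms `u_1^{(n)}` and `u_2^{(n)}` are sought among
the functions of mean zero. -/
def IsAsymptoticProcedure (𝔸 : TensorField) (χ : EuclideanSpace ℝ (Fin 3)) (z : ℂ) (f : L2Vec)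
    (u : ℕ → Fin 3 → H1per) : Prop :=
  ∀ n : ℕ, mean (u n 1) = 0 ∧ mean (u n 2) = 0 ∧
    ∀ v : H1per, collect 𝔸 χ z f u n ((n : ℤ) - 2) v = 0 ∧
      collect 𝔸 χ z f u n ((n : ℤ) - 1) v = 0 ∧ collect 𝔸 χ z f u n (n : ℤ) v = 0

/-- The system of equations for the triple `w = (u_0, u_1, u_2)` of one cycle, with data `g` (which
is `f` in cycle `0` and `0` afterwards), `p = u_1^{(n-1)}`, `q = u_2^{(n-1)}`, `r = u_2^{(n-2)}`
(which are `0` if the upper index is negative). -/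
structure CycleProblem (𝔸 : TensorField) (χ : EuclideanSpace ℝ (Fin 3)) (z : ℂ)
    (g : L2Vec) (p q r : H1per) (w : Fin 3 → H1per) : Prop where
  eq_zero : ∀ v : H1per, energy 𝔸 (symGrad (w 0)) (symGrad v) = 0
  eq_one : ∀ v : H1per,
    energy 𝔸 (symGrad (w 1)) (symGrad v) = - energy 𝔸 (iXfn χ (w 0)) (symGrad v)
  mean_one : mean (w 1) = 0
  eq_two : ∀ v : H1per,
    energy 𝔸 (symGrad (w 2)) (symGrad v) =
      - energy 𝔸 (iXfn χ (w 1 + q)) (symGrad v) - energy 𝔸 (symGrad (w 1 + q)) (iXfn χ v)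
      - energy 𝔸 (iXfn χ (w 0 + p + r)) (iXfn χ v)
      + z * (‖χ‖ : ℂ) ^ 2 * mass (fn (w 0 + p + r)) (fn v) + (‖χ‖ : ℂ) ^ 2 * mass g (fn v)
  mean_two : mean (w 2) = 0
  eq_hom : ∀ v₀ : Vec,
    ((‖χ‖ : ℂ) ^ 2)⁻¹ * homPairing 𝔸 χ (mean (w 0)) v₀ - z * mass (fn (w 0)) (fun _ => v₀) =
      mass g (fun _ => v₀)
      - ((‖χ‖ : ℂ) ^ 2)⁻¹ * energy 𝔸 (symGrad q + iXfn χ (p + r)) (fun _ => iX χ v₀)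

/-- The residual functional `ℛ_error^{(n)}`, with `q = u_2^{(n-1)}`, `w₁ = u_1^{(n)}` and
`w₂ = u_2^{(n)}`. -/
def residual (𝔸 : TensorField) (χ : EuclideanSpace ℝ (Fin 3)) (z : ℂ)
    (q w₁ w₂ v : H1per) : ℂ :=
  - energy 𝔸 (iXfn χ q) (iXfn χ v) - energy 𝔸 (iXfn χ w₁) (iXfn χ v)
  - energy 𝔸 (symGrad w₂) (iXfn χ v) - energy 𝔸 (iXfn χ w₂) (symGrad v)
  - energy 𝔸 (iXfn χ w₂) (iXfn χ v)
  + z * (‖χ‖ : ℂ) ^ 2 * mass (fn q) (fn v) + z * (‖χ‖ : ℂ) ^ 2 * mass (fn w₁) (fn v)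
  + z * (‖χ‖ : ℂ) ^ 2 * mass (fn w₂) (fn v)

/-- The error term `u_error^{(n)}`. -/
def errorTerm (U : H1per) (u : ℕ → Fin 3 → H1per) (n : ℕ) : H1per :=
  U - ∑ k ∈ Finset.range (n + 1), (u k 0 + u k 1 + u k 2)

end Elasticity

end

/-! Everything rests on one coercivity estimate: on mean-zero periodic fields the elastic energy of
`sym ∇ w` controls the full `H¹` norm. It combines three facts. Parseval gives the Poincaré
inequality (`integral_sq_le_of_smoothPeriodicScalar`). Two integrations by parts turn `∫ ∇φ : conj
(∇φ)ᵀ` into `∫ |div φ|² ≥ 0`, which is Korn's inequality with constant 2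
(`norm_sq_snd_le_of_mem_smoothPeriodic`). Ellipticity on real symmetric matrices extends to complex
ones (`re_inner_applyTensor_ge`). The two inequalities are proved for smooth fields and pass to the
closure.

The remaining analysis is Hilbert space algebra, carried out in `CellSystem`. By Lax–Milgram, a cell
problem is solvable once its load annihilates the constants, and its mean-zero solution is unique
(`exists_solution_operator`). In one cycle, zero energy forces `u₀` to be a constant `c`, and then
`u₁` is the corrector of `c`. The problem for `u₂` is solvable exactly when its load annihilates the
constants, and this condition is the homogenized equation for `c` (`solvable_iff_homEq`). Since `z`
is in the resolvent set of the homogenized matrix, `c` is determined by the data, and the whole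
triple is a bounded linear function of them (`cycle_iff`).

The asymptotic procedure reduces to these cycles because each new equation contains the full sum of
an equation that held one cycle earlier; only the contributions of the new terms survive
(`isAsymptoticProcedure_iff`). The error equation follows by induction: subtracting one more cycle
from the solution turns the old residual into the new one (`CellSystem.CycleEqs.residual_step`). -/

namespace Elasticity

/-! ### Smooth periodic scalar functions -/

/-- A smooth `ℤ³`-periodic scalar function. -/
def SmoothPeriodicScalar (f : (Fin 3 → ℝ) → ℂ) : Prop :=
  ContDiff ℝ ∞ f ∧ ∀ y (a : Fin 3), f (y + Pi.single a 1) = f y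

/-- The partial derivative `∂_j f`. -/
noncomputable def partialDeriv (j : Fin 3) (f : (Fin 3 → ℝ) → ℂ) (y : Fin 3 → ℝ) : ℂ :=
  fderiv ℝ f y (Pi.single j 1)

namespace SmoothPeriodicScalar

variable {f g : (Fin 3 → ℝ) → ℂ}

theorem differentiableAt (hf : SmoothPeriodicScalar f) (y) : DifferentiableAt ℝ f y :=
  hf.1.differentiable (by simp) y

theorem mul (hf : SmoothPeriodicScalar f) (hg : SmoothPeriodicScalar g) :
    SmoothPeriodicScalar (fun y => f y * g y) :=
  ⟨hf.1.mul hg.1, fun y a => by simp only [hf.2, hg.2]⟩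

theorem star (hf : SmoothPeriodicScalar f) : SmoothPeriodicScalar (fun y => star (f y)) :=
  ⟨(Complex.conjCLE : ℂ ≃L[ℝ] ℂ).contDiff.comp hf.1, fun y a => by simp only [hf.2]⟩

theorem partialDeriv (hf : SmoothPeriodicScalar f) (j : Fin 3) :
    SmoothPeriodicScalar (partialDeriv j f) := by
  refine ⟨(hf.1.fderiv_right (m := ∞) (by simp)).clm_apply contDiff_const, fun y a => ?_⟩
  have h : (fun x => f (x + Pi.single a 1)) = f := funext fun x => hf.2 x a
  unfold Elasticity.partialDeriv
  conv_rhs => rw [← h]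
  rw [fderiv_comp_add_right]

theorem continuous (hf : SmoothPeriodicScalar f) : Continuous f := hf.1.continuous

end SmoothPeriodicScalar

theorem partialDeriv_mul {f g : (Fin 3 → ℝ) → ℂ} (hf : SmoothPeriodicScalar f)
    (hg : SmoothPeriodicScalar g) (j : Fin 3) (y) :
    partialDeriv j (fun y => f y * g y) y =
      partialDeriv j f y * g y + f y * partialDeriv j g y := by
  unfold partialDeriv
  rw [fderiv_fun_mul (hf.differentiableAt y) (hg.differentiableAt y)]
  simp
  ring

theorem partialDeriv_star {f : (Fin 3 → ℝ) → ℂ} (hf : SmoothPeriodicScalar f) (j : Fin 3) (y) :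
    partialDeriv j (fun y => star (f y)) y = star (partialDeriv j f y) := by
  have h := ((Complex.conjCLE : ℂ ≃L[ℝ] ℂ).hasFDerivAt (x := f y)).comp y
    (hf.differentiableAt y).hasFDerivAt
  unfold partialDeriv
  rw [show (fun y => star (f y)) = (Complex.conjCLE : ℂ ≃L[ℝ] ℂ) ∘ f from rfl, h.fderiv]
  simp

theorem partialDeriv_comm {f : (Fin 3 → ℝ) → ℂ} (hf : SmoothPeriodicScalar f) (i j : Fin 3) (y) :
    partialDeriv i (partialDeriv j f) y = partialDeriv j (partialDeriv i f) y := by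
  have hd : DifferentiableAt ℝ (fderiv ℝ f) y :=
    ((hf.1.fderiv_right (m := ∞) (by simp)).differentiable (by simp)) y
  have hs : IsSymmSndFDerivAt ℝ f y :=
    (hf.1.contDiffAt (x := y)).isSymmSndFDerivAt (by
      rw [minSmoothness_of_isRCLikeNormedField]
      exact WithTop.coe_le_coe.2 (le_top : (2 : ℕ∞) ≤ ⊤))
  have key : ∀ a b : Fin 3, partialDeriv a (partialDeriv b f) y =
      fderiv ℝ (fderiv ℝ f) y (Pi.single a 1) (Pi.single b 1) := by
    intro a b
    unfold partialDeriv
    rw [fderiv_clm_apply hd (differentiableAt_const _)]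
    simp
  rw [key, key, hs.eq]

/-! ### The unit cell and integration by parts over it -/

theorem isCompact_closedCell : IsCompact (Set.Icc (0 : Fin 3 → ℝ) 1) := isCompact_Icc

/-- Compactness arguments and the divergence theorem need the closed box; the faces that distinguish
it from the half-open cell are null sets. -/
theorem cell_ae_eq_Icc : cell =ᵐ[volume] Set.Icc (0 : Fin 3 → ℝ) 1 := by
  exact Measure.univ_pi_Ico_ae_eq_Icc (μ := fun _ : Fin 3 => (volume : Measure ℝ))
    (f := fun _ => (0 : ℝ)) (g := fun _ => (1 : ℝ))

theorem measurableSet_cell : MeasurableSet cell :=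
  MeasurableSet.univ_pi fun _ => measurableSet_Ico

instance : IsProbabilityMeasure cellMeasure := ⟨by
  rw [Measure.restrict_apply_univ, cell, Real.volume_pi_Ico]; simp⟩

theorem memLp_of_continuous {E : Type*} [NormedAddCommGroup E] {f : (Fin 3 → ℝ) → E}
    (hf : Continuous f) (p : ENNReal) : MemLp f p cellMeasure := by
  rw [cellMeasure, Measure.restrict_congr_set cell_ae_eq_Icc]
  obtain ⟨C, hC⟩ := isCompact_closedCell.exists_bound_of_continuousOn hf.continuousOn
  have : IsFiniteMeasure (volume.restrict (Set.Icc (0 : Fin 3 → ℝ) 1)) :=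
    ⟨by rw [Measure.restrict_apply_univ]; exact isCompact_closedCell.measure_lt_top⟩
  have hm : AEStronglyMeasurable f (volume.restrict (Set.Icc (0 : Fin 3 → ℝ) 1)) :=
    hf.continuousOn.aestronglyMeasurable_of_isCompact isCompact_closedCell measurableSet_Icc
  exact MemLp.of_bound hm C
    ((ae_restrict_iff' measurableSet_Icc).2 (Filter.Eventually.of_forall hC))

theorem integrable_of_continuous {E : Type*} [NormedAddCommGroup E] {f : (Fin 3 → ℝ) → E}
    (hf : Continuous f) : Integrable f cellMeasure :=
  memLp_one_iff_integrable.1 (memLp_of_continuous hf 1)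

/-- Divergence theorem for the field whose only nonzero component is `f`, in direction `j`: the
integrals over opposite faces cancel by periodicity. -/
theorem integral_partialDeriv {f : (Fin 3 → ℝ) → ℂ} (hf : SmoothPeriodicScalar f) (j : Fin 3) :
    ∫ y, partialDeriv j f y ∂cellMeasure = 0 := by
  rw [cellMeasure, Measure.restrict_congr_set cell_ae_eq_Icc]
  have hi := integrable_of_continuous (hf.partialDeriv j).continuous
  rw [cellMeasure, Measure.restrict_congr_set cell_ae_eq_Icc] at hi
  have hsum : ∀ y, ∑ i, (if i = j then fderiv ℝ f y else 0) (Pi.single i 1) =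
      partialDeriv j f y := by
    intro y
    rw [Finset.sum_eq_single j (fun b _ hb => by simp [hb]) (by simp)]
    simp [partialDeriv]
  have h := integral_divergence_of_hasFDerivAt_off_countable' (n := 2) (E := ℂ) 0 1 zero_le_one
    (fun i => if i = j then f else 0) (fun i y => if i = j then fderiv ℝ f y else 0) ∅
    Set.countable_empty
    (fun i => by
      split_ifs
      · exact hf.continuous.continuousOn
      · exact continuousOn_const)
    (fun y _ i => by
      split_ifs
      · exact (hf.differentiableAt y).hasFDerivAt
      · exact hasFDerivAt_const _ _)
    (by simp only [hsum]; exact hi)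
  simp only [hsum] at h
  rw [h]
  refine Finset.sum_eq_zero fun i _ => ?_
  by_cases hij : i = j
  · subst hij
    rw [sub_eq_zero]
    congr 1
    funext x
    simp only [if_true]
    -- The face `x i = 1` is the face `x i = 0` translated by the `i`-th unit vector.
    rw [← hf.2 (i.insertNth ((0 : Fin 3 → ℝ) i) x) i]
    congr 1
    funext k
    refine Fin.succAboveCases i ?_ (fun l => ?_) k <;> simp
  · simp [hij]

theorem integral_partialDeriv_mul {f g : (Fin 3 → ℝ) → ℂ} (hf : SmoothPeriodicScalar f)
    (hg : SmoothPeriodicScalar g) (j : Fin 3) :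
    ∫ y, partialDeriv j f y * g y ∂cellMeasure =
      - ∫ y, f y * partialDeriv j g y ∂cellMeasure := by
  have h := integral_partialDeriv (hf.mul hg) j
  simp only [partialDeriv_mul hf hg] at h
  rw [integral_add] at h
  · exact eq_neg_of_add_eq_zero_left h
  · exact integrable_of_continuous ((hf.partialDeriv j).mul hg).continuous
  · exact integrable_of_continuous (hf.mul (hg.partialDeriv j)).continuous

/-- Both sides become the integral of `f` against a mixed second derivative of `g`, and mixed
derivatives commute. This is the identity behind Korn's inequality. -/
theorem integral_partialDeriv_mul_star_comm {f g : (Fin 3 → ℝ) → ℂ} (hf : SmoothPeriodicScalar f)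
    (hg : SmoothPeriodicScalar g) (i j : Fin 3) :
    ∫ y, partialDeriv j f y * star (partialDeriv i g y) ∂cellMeasure =
      ∫ y, partialDeriv i f y * star (partialDeriv j g y) ∂cellMeasure := by
  rw [integral_partialDeriv_mul hf (hg.partialDeriv i).star,
    integral_partialDeriv_mul hf (hg.partialDeriv j).star]
  congr 2
  funext y
  rw [partialDeriv_star (hg.partialDeriv i), partialDeriv_star (hg.partialDeriv j),
    partialDeriv_comm hg]

/-! ### Fourier series and the Poincaré inequality -/

/-- The normalized Haar measure on the circle. -/
noncomputable local instance circleMeasureSpace : MeasureSpace UnitAddCircle := ⟨AddCircle.haarAddCircle⟩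

local instance circleIsProbabilityMeasure :
    IsProbabilityMeasure (volume : Measure UnitAddCircle) :=
  inferInstanceAs (IsProbabilityMeasure AddCircle.haarAddCircle)

/-- The exponential `y ↦ exp (-2πi n·y)`. -/
noncomputable def character (n : Fin 3 → ℤ) (y : Fin 3 → ℝ) : ℂ :=
  UnitAddTorus.mFourier (-n) fun i => (y i : UnitAddCircle)

theorem character_eq_exp (n : Fin 3 → ℤ) (y : Fin 3 → ℝ) :
    character n y = Complex.exp (∑ i, -(2 * Real.pi * Complex.I * n i) * y i) := by
  simp only [character, UnitAddTorus.mFourier, ContinuousMap.coe_mk, fourier_coe_apply,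
    Complex.exp_sum]
  refine Finset.prod_congr rfl fun i _ => ?_
  congr 1
  simp

theorem smoothPeriodicScalar_character (n : Fin 3 → ℤ) : SmoothPeriodicScalar (character n) := by
  constructor
  · simp only [funext (character_eq_exp n)]
    refine Complex.contDiff_exp.comp (ContDiff.sum fun i _ => contDiff_const.mul ?_)
    exact Complex.ofRealCLM.contDiff.comp (contDiff_apply ℝ ℝ i)
  · intro y a
    unfold character
    congr 1
    funext i
    by_cases h : i = a
    · subst h
      simp
    · simp [h]

theorem partialDeriv_character (n : Fin 3 → ℤ) (j : Fin 3) (y : Fin 3 → ℝ) :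
    partialDeriv j (character n) y = -(2 * Real.pi * Complex.I * n j) * character n y := by
  let l : Fin 3 → (Fin 3 → ℝ) →L[ℝ] ℂ := fun i => Complex.ofRealCLM.comp (.proj i)
  have h1 : ∀ i : Fin 3, HasFDerivAt (fun y => -(2 * Real.pi * Complex.I * n i) * l i y)
      (-(2 * Real.pi * Complex.I * n i) • l i) y := fun i =>
    (l i).hasFDerivAt.const_mul _
  have h2 : HasFDerivAt (fun y : Fin 3 → ℝ =>
      Complex.exp (∑ i, -(2 * Real.pi * Complex.I * n i) * y i)) _ y :=
    (HasFDerivAt.fun_sum (u := Finset.univ) fun i _ => h1 i).cexp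
  unfold partialDeriv
  rw [funext (character_eq_exp n), h2.fderiv]
  simp [l, Pi.single_apply, apply_ite ((↑) : ℝ → ℂ)]
  ring

/-- The Fourier coefficients of a function on the unit cell. -/
noncomputable def fourierCoeffCell (f : (Fin 3 → ℝ) → ℂ) (n : Fin 3 → ℤ) : ℂ :=
  ∫ y, f y * character n y ∂cellMeasure

theorem fourierCoeffCell_partialDeriv {f : (Fin 3 → ℝ) → ℂ} (hf : SmoothPeriodicScalar f)
    (j : Fin 3) (n : Fin 3 → ℤ) :
    fourierCoeffCell (partialDeriv j f) n =
      2 * Real.pi * Complex.I * n j * fourierCoeffCell f n := by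
  unfold fourierCoeffCell
  rw [integral_partialDeriv_mul hf (smoothPeriodicScalar_character n), ← integral_const_mul,
    ← integral_neg]
  congr 1
  funext y
  rw [partialDeriv_character]
  ring

/-- The left-hand set is the fundamental domain in which integrals over the torus are unfolded. -/
theorem cell_ae_eq_Ioc :
    {x : Fin 3 → ℝ | ∀ i, x i ∈ Set.Ioc ((0 : Fin 3 → ℝ) i) ((0 : Fin 3 → ℝ) i + 1)}
      =ᵐ[volume] cell := by
  refine Filter.EventuallyEq.trans ?_ cell_ae_eq_Icc.symm
  have h : (Set.univ.pi fun _ : Fin 3 => Set.Ioc (0 : ℝ) 1) =ᵐ[volume] Set.Icc 0 1 :=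
    Measure.univ_pi_Ioc_ae_eq_Icc (μ := fun _ : Fin 3 => (volume : Measure ℝ))
      (f := fun _ => (0 : ℝ)) (g := fun _ => (1 : ℝ))
  have hs : {x : Fin 3 → ℝ | ∀ i, x i ∈ Set.Ioc ((0 : Fin 3 → ℝ) i) ((0 : Fin 3 → ℝ) i + 1)} =
      Set.univ.pi fun _ : Fin 3 => Set.Ioc (0 : ℝ) 1 := by
    ext x
    simp
  rw [hs]
  exact h

/-- Parseval's identity, transported from the torus. -/
theorem hasSum_sq_fourierCoeffCell {f : (Fin 3 → ℝ) → ℂ} (hf : Continuous f) :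
    HasSum (fun n => ‖fourierCoeffCell f n‖ ^ 2) (∫ y, ‖f y‖ ^ 2 ∂cellMeasure) := by
  -- `F` evaluates `f` at the representatives in `(0,1]`. It may jump across the seam, but it is
  -- measurable and bounded, which suffices for `L²`.
  let F : UnitAddTorus (Fin 3) → ℂ := fun x =>
    f fun i => (AddCircle.equivIoc (1 : ℝ) 0 (x i) : ℝ)
  have hFf : ∀ y ∈ {x : Fin 3 → ℝ |
      ∀ i, x i ∈ Set.Ioc ((0 : Fin 3 → ℝ) i) ((0 : Fin 3 → ℝ) i + 1)},
      F (fun i => (y i : UnitAddCircle)) = f y := by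
    intro y hy
    simp only [F]
    congr 1
    funext i
    exact AddCircle.equivIoc_coe_of_mem (p := (1 : ℝ)) (a := 0) (by simpa using hy i)
  have hm : MeasurableSet {x : Fin 3 → ℝ |
      ∀ i, x i ∈ Set.Ioc ((0 : Fin 3 → ℝ) i) ((0 : Fin 3 → ℝ) i + 1)} :=
    MeasurableSet.univ_pi' fun _ => measurableSet_Ioc
  have hFm : Measurable F := hf.measurable.comp <| measurable_pi_lambda _ fun i =>
    measurable_subtype_coe.comp
      ((AddCircle.measurableEquivIoc (1 : ℝ) 0).measurable.comp (measurable_pi_apply i))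
  obtain ⟨C, hC⟩ := isCompact_closedCell.exists_bound_of_continuousOn hf.continuousOn
  have hF : MemLp F 2 (volume : Measure (UnitAddTorus (Fin 3))) := by
    refine MemLp.of_bound hFm.aestronglyMeasurable C (Filter.Eventually.of_forall fun x => hC _ ?_)
    have h := fun i => (AddCircle.equivIoc (1 : ℝ) 0 (x i)).2
    exact ⟨fun i => (h i).1.le, fun i => by simpa using (h i).2⟩
  have hP := UnitAddTorus.hasSum_sq_mFourierCoeff hF.toLp
  have e1 : ∀ n, UnitAddTorus.mFourierCoeff hF.toLp n = fourierCoeffCell f n := by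
    intro n
    have : UnitAddTorus.mFourierCoeff hF.toLp n = UnitAddTorus.mFourierCoeff F n :=
      integral_congr_ae (hF.coeFn_toLp.mono fun x hx => by simp only [hx])
    rw [this, UnitAddTorus.mFourierCoeff_eq_integral F n 0, fourierCoeffCell, cellMeasure,
      ← Measure.restrict_congr_set cell_ae_eq_Ioc]
    refine setIntegral_congr_fun hm fun y hy => ?_
    simp only [hFf y hy, smul_eq_mul, character]
    ring
  have e2 : ∫ t, ‖(hF.toLp : UnitAddTorus (Fin 3) → ℂ) t‖ ^ 2 = ∫ y, ‖f y‖ ^ 2 ∂cellMeasure := by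
    have : ∫ t, ‖(hF.toLp : UnitAddTorus (Fin 3) → ℂ) t‖ ^ 2 = ∫ t, ‖F t‖ ^ 2 :=
      integral_congr_ae (hF.coeFn_toLp.mono fun x hx => by simp only [hx])
    rw [this, UnitAddTorus.integral_preimage _ 0, cellMeasure,
      ← Measure.restrict_congr_set cell_ae_eq_Ioc]
    exact setIntegral_congr_fun hm fun y hy => by simp only [hFf y hy]
  simpa only [e1, e2] using hP

/-- The Poincaré inequality on the periodic unit cell. -/
theorem integral_sq_le_of_smoothPeriodicScalar {f : (Fin 3 → ℝ) → ℂ}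
    (hf : SmoothPeriodicScalar f) :
    ∫ y, ‖f y‖ ^ 2 ∂cellMeasure ≤
      ‖∫ y, f y ∂cellMeasure‖ ^ 2 + ∑ j, ∫ y, ‖partialDeriv j f y‖ ^ 2 ∂cellMeasure := by
  have h0 : fourierCoeffCell f 0 = ∫ y, f y ∂cellMeasure := by
    simp [fourierCoeffCell, character, UnitAddTorus.mFourier_zero]
  have hD := hasSum_sum (s := Finset.univ) fun (j : Fin 3) _ =>
    hasSum_sq_fourierCoeffCell (hf.partialDeriv j).continuous
  -- The squared mean is written as a series supported at frequency zero, so that both sides of the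
  -- inequality can be compared frequency by frequency.
  have h1 := hasSum_ite_eq (0 : Fin 3 → ℤ) (‖fourierCoeffCell f 0‖ ^ 2)
  rw [← h0]
  refine hasSum_le (fun n => ?_) (hasSum_sq_fourierCoeffCell hf.continuous) (h1.add hD)
  by_cases hn : n = 0
  · subst hn
    simp only [if_true, le_add_iff_nonneg_right]
    positivity
  · obtain ⟨j, hj⟩ := Function.ne_iff.1 hn
    simp only [hn, if_false, zero_add]
    refine le_trans ?_ (Finset.single_le_sum
      (f := fun j => ‖fourierCoeffCell (partialDeriv j f) n‖ ^ 2)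
      (fun _ _ => by positivity) (Finset.mem_univ j))
    simp only [fourierCoeffCell_partialDeriv hf]
    -- A nonzero integer frequency has some `|n j| ≥ 1`, so differentiation in direction `j`
    -- multiplies the coefficient by at least `2π ≥ 1`.
    have hone : (1 : ℝ) ≤ ‖(2 * Real.pi * Complex.I * n j : ℂ)‖ := by
      have h2 : (1 : ℝ) ≤ |(n j : ℝ)| := by exact_mod_cast Int.one_le_abs hj
      simp only [norm_mul, Complex.norm_I, mul_one, Complex.norm_real, Complex.norm_intCast,
        Complex.norm_ofNat, Real.norm_eq_abs, abs_of_pos Real.pi_pos]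
      nlinarith [Real.pi_gt_three]
    rw [norm_mul]
    gcongr
    exact le_mul_of_one_le_left (norm_nonneg _) hone

/-! ### Coercive cell systems in Hilbert spaces -/

local notation "⟪" x ", " y "⟫" => inner ℂ x y

/-- The operators that enter a cell problem: `D` is the symmetrized gradient, `X` the zero-order
operator `i X_χ`, `M` the multiplication by the coefficients, `F` the embedding in `L²`, `K` the
inclusion of the constants and `m` the mean. -/
structure CellSystem (W G L C : Type*) [NormedAddCommGroup W] [InnerProductSpace ℂ W]
    [NormedAddCommGroup G] [InnerProductSpace ℂ G] [NormedAddCommGroup L] [InnerProductSpace ℂ L]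
    [NormedAddCommGroup C] [InnerProductSpace ℂ C] where
  D : W →L[ℂ] G
  X : W →L[ℂ] G
  M : G →L[ℂ] G
  F : W →L[ℂ] L
  K : C →L[ℂ] W
  m : W →L[ℂ] C
  m_K : ∀ a, m (K a) = a
  D_K : ∀ a, D (K a) = 0
  inner_F_K : ∀ a w, ⟪F (K a), F w⟫ = ⟪a, m w⟫
  coercive : ∃ c : ℝ, 0 < c ∧ ∀ w, m w = 0 → c * ‖w‖ ^ 2 ≤ RCLike.re ⟪D w, M (D w)⟫

namespace CellSystem

set_option linter.unusedSectionVars false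

variable {W G L C : Type*} [NormedAddCommGroup W] [InnerProductSpace ℂ W]
  [NormedAddCommGroup G] [InnerProductSpace ℂ G] [NormedAddCommGroup L] [InnerProductSpace ℂ L]
  [NormedAddCommGroup C] [InnerProductSpace ℂ C] (P : CellSystem W G L C)

theorem eq_zero_of_form_eq_zero {w : W} (hm : P.m w = 0) (h : ⟪P.D w, P.M (P.D w)⟫ = 0) :
    w = 0 := by
  obtain ⟨c, hc, hP⟩ := P.coercive
  have h1 := hP w hm
  rw [h, map_zero] at h1
  have h2 : ‖w‖ ^ 2 ≤ 0 := by nlinarith [sq_nonneg ‖w‖]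
  simpa using le_antisymm h2 (sq_nonneg _)

/-- Subtracting the constant `K (m w)` leaves `D w` unchanged and makes the mean zero, where
coercivity applies. -/
theorem eq_K_of_form_eq_zero {w : W} (h : ⟪P.D w, P.M (P.D w)⟫ = 0) : w = P.K (P.m w) := by
  have h1 := P.eq_zero_of_form_eq_zero (w := w - P.K (P.m w)) (by simp [P.m_K])
    (by simpa [P.D_K] using h)
  exact sub_eq_zero.1 h1

theorem eq_of_form_eq {u w : W} (hu : P.m u = 0) (hw : P.m w = 0)
    (h : ∀ v, ⟪P.D v, P.M (P.D u)⟫ = ⟪P.D v, P.M (P.D w)⟫) : u = w := by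
  rw [← sub_eq_zero]
  refine P.eq_zero_of_form_eq_zero (by simp [hu, hw]) ?_
  rw [map_sub, map_sub, inner_sub_right, ← map_sub, h, sub_self]

variable [CompleteSpace W] [CompleteSpace G] [CompleteSpace L] [CompleteSpace C]

-- Lax–Milgram. The form degenerates on the constants, so the penalty `m* m` is added; the sum `T`
-- is coercive on all of `W`, and its inverse is a bounded linear solution operator. When the load
-- annihilates the constants, testing with them shows that the penalty vanishes at the solution,
-- which therefore has mean zero and solves the original problem.
open ContinuousLinearMap in
theorem exists_solution_operator : ∃ S : W →L[ℂ] W, ∀ l : W, (∀ a, ⟪P.K a, l⟫ = 0) →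
    P.m (S l) = 0 ∧ ∀ v, ⟪P.D v, P.M (P.D (S l))⟫ = ⟪v, l⟫ := by
  obtain ⟨c, hc, hP⟩ := P.coercive
  let T : W →L[ℂ] W := adjoint P.D ∘L P.M ∘L P.D + adjoint P.m ∘L P.m
  have hT : ∀ v w, ⟪v, T w⟫ = ⟪P.D v, P.M (P.D w)⟫ + ⟪P.m v, P.m w⟫ := by
    intro v w
    simp [T, adjoint_inner_right]
  have hunit : IsUnit T := by
    let κ := ‖P.K‖
    -- With `d` the energy of `w`, splitting off the mean gives `‖w‖² ≤ (2/c) d + 2κ² ‖m w‖²`; `e`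
    -- is the inverse of a common bound for both coefficients.
    let e : ℝ := (2 / c + 2 * κ ^ 2 + 1)⁻¹
    have hden : 0 < 2 / c + 2 * κ ^ 2 + 1 := by positivity
    have he : 0 < e := inv_pos.2 hden
    refine isUnit_of_forall_le_norm_inner_map T (c := ⟨e, he.le⟩) he fun w => ?_
    have h1 := hP (w - P.K (P.m w)) (by simp [P.m_K])
    simp only [map_sub, P.D_K, sub_zero] at h1
    set d := RCLike.re ⟪P.D w, P.M (P.D w)⟫
    have h2 : ‖w‖ ≤ ‖w - P.K (P.m w)‖ + κ * ‖P.m w‖ := by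
      calc ‖w‖ = ‖(w - P.K (P.m w)) + P.K (P.m w)‖ := by simp
        _ ≤ _ := (norm_add_le _ _).trans (by gcongr; exact P.K.le_opNorm _)
    have h3 : ‖w‖ ^ 2 ≤ 2 * ‖w - P.K (P.m w)‖ ^ 2 + 2 * κ ^ 2 * ‖P.m w‖ ^ 2 := by
      have := pow_le_pow_left₀ (norm_nonneg w) h2 2
      nlinarith [sq_nonneg (‖w - P.K (P.m w)‖ - κ * ‖P.m w‖)]
    have h4 : ‖w - P.K (P.m w)‖ ^ 2 ≤ d / c := by
      rw [le_div_iff₀ hc]; linarith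
    have hd : 0 ≤ d := le_trans (by positivity) h1
    have h5 : ‖w‖ ^ 2 ≤ (2 / c + 2 * κ ^ 2 + 1) * (d + ‖P.m w‖ ^ 2) := by
      have : 2 * (d / c) = 2 / c * d := by ring
      have h6 : 0 ≤ 2 / c * ‖P.m w‖ ^ 2 := by positivity
      have h7 : 0 ≤ 2 * κ ^ 2 * d := by positivity
      nlinarith [sq_nonneg ‖P.m w‖]
    have h6 : ‖w‖ ^ 2 * e ≤ d + ‖P.m w‖ ^ 2 := by
      rw [← div_eq_mul_inv, div_le_iff₀' hden]; exact h5
    have h7 : RCLike.re ⟪w, T w⟫ = d + ‖P.m w‖ ^ 2 := by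
      rw [hT, map_add, inner_self_eq_norm_sq]
    rw [norm_inner_symm]
    exact (h6.trans_eq h7.symm).trans (RCLike.re_le_norm _)
  obtain ⟨S, hS⟩ := hunit.exists_right_inv
  refine ⟨S, fun l hl => ?_⟩
  have hTS : T (S l) = l := by
    have := congrArg (fun A : W →L[ℂ] W => A l) hS
    simpa using this
  have hm : P.m (S l) = 0 := by
    refine ext_inner_left ℂ fun a => ?_
    have h := hT (P.K a) (S l)
    rw [hTS, hl, P.D_K, inner_zero_left, zero_add, P.m_K] at h
    rw [← h, inner_zero_right]
  refine ⟨hm, fun v => ?_⟩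
  have h := hT v (S l)
  rw [hTS, hm, inner_zero_right, add_zero] at h
  exact h.symm

/-- A solution operator of the mean-zero cell problems. -/
noncomputable def S : W →L[ℂ] W := P.exists_solution_operator.choose

theorem m_S {l : W} (hl : ∀ a, ⟪P.K a, l⟫ = 0) : P.m (P.S l) = 0 :=
  (P.exists_solution_operator.choose_spec l hl).1

theorem form_S {l : W} (hl : ∀ a, ⟪P.K a, l⟫ = 0) (v : W) :
    ⟪P.D v, P.M (P.D (P.S l))⟫ = ⟪v, l⟫ :=
  (P.exists_solution_operator.choose_spec l hl).2 v

/-! ### Correctors, the homogenized operator and the equations of one cycle -/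

open ContinuousLinearMap

/-- The corrector of a constant. -/
noncomputable def cor : C →L[ℂ] W := -(P.S ∘L adjoint P.D ∘L P.M ∘L P.X ∘L P.K)

/-- Loads of the form `D* b` satisfy the solvability condition automatically, so correctors exist
for every constant. -/
theorem inner_K_adjoint_D (a : C) (b : G) : ⟪P.K a, adjoint P.D b⟫ = 0 := by
  rw [adjoint_inner_right, P.D_K, inner_zero_left]

theorem m_cor (a : C) : P.m (P.cor a) = 0 := by
  simp [cor, P.m_S (P.inner_K_adjoint_D · _)]

theorem form_cor (a : C) (v : W) :
    ⟪P.D v, P.M (P.D (P.cor a))⟫ = -⟪P.D v, P.M (P.X (P.K a))⟫ := by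
  simp [cor, P.form_S (P.inner_K_adjoint_D · _), adjoint_inner_right]

theorem eq_cor {a : C} {w : W} (hm : P.m w = 0)
    (h : ∀ v, ⟪P.D v, P.M (P.D w)⟫ = -⟪P.D v, P.M (P.X (P.K a))⟫) : w = P.cor a :=
  P.eq_of_form_eq hm (P.m_cor a) fun v => by rw [h, P.form_cor]

/-- The homogenized operator. -/
noncomputable def hom : C →L[ℂ] C :=
  adjoint (P.X ∘L P.K) ∘L P.M ∘L (P.D ∘L P.cor + P.X ∘L P.K)

theorem inner_hom (a b : C) :
    ⟪a, P.hom b⟫ = ⟪P.X (P.K a), P.M (P.D (P.cor b) + P.X (P.K b))⟫ := by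
  simp [hom, adjoint_inner_right]

/-- The equations of one cycle of the expansion, except the homogenized one. -/
structure CycleEqs (z s : ℂ) (g : L) (p q r w₀ w₁ w₂ : W) : Prop where
  zero : ∀ v, ⟪P.D v, P.M (P.D w₀)⟫ = 0
  one : ∀ v, ⟪P.D v, P.M (P.D w₁)⟫ = -⟪P.D v, P.M (P.X w₀)⟫
  m_one : P.m w₁ = 0
  two : ∀ v, ⟪P.D v, P.M (P.D w₂)⟫ = -⟪P.D v, P.M (P.X (w₁ + q))⟫ - ⟪P.X v, P.M (P.D (w₁ + q))⟫
    - ⟪P.X v, P.M (P.X (w₀ + p + r))⟫ + z * s * ⟪P.F v, P.F (w₀ + p + r)⟫ + s * ⟪P.F v, g⟫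
  m_two : P.m w₂ = 0

/-- The homogenized equation of one cycle. -/
def HomEq (z s : ℂ) (g : L) (p q r w₀ : W) : Prop :=
  ∀ a, s⁻¹ * ⟪a, P.hom (P.m w₀)⟫ - z * ⟪a, P.m w₀⟫ =
    ⟪P.F (P.K a), g⟫ - s⁻¹ * ⟪P.X (P.K a), P.M (P.D q + P.X (p + r))⟫

variable {P} {z s : ℂ} {g : L} {p q r w₀ w₁ w₂ : W}

theorem CycleEqs.eq_K (h : P.CycleEqs z s g p q r w₀ w₁ w₂) : w₀ = P.K (P.m w₀) :=
  P.eq_K_of_form_eq_zero (h.zero w₀)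

theorem CycleEqs.eq_cor (h : P.CycleEqs z s g p q r w₀ w₁ w₂) : w₁ = P.cor (P.m w₀) :=
  P.eq_cor h.m_one fun v => by rw [h.one, ← h.eq_K]

/-- The solvability condition of the second corrector problem is the homogenized equation. -/
theorem solvable_iff_homEq (hs : s ≠ 0) (hp : P.m p = 0) (hr : P.m r = 0) (c : C) :
    (∀ a, 0 = - ⟪P.X (P.K a), P.M (P.D (P.cor c + q))⟫
      - ⟪P.X (P.K a), P.M (P.X (P.K c + p + r))⟫
      + z * s * ⟪P.F (P.K a), P.F (P.K c + p + r)⟫ + s * ⟪P.F (P.K a), g⟫) ↔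
    P.HomEq z s g p q r (P.K c) := by
  unfold HomEq
  refine forall_congr' fun a => ?_
  -- The mass terms with `p` and `r` reduce to their means and drop out; what is left is the
  -- homogenized equation multiplied by `s`.
  simp only [P.m_K, P.inner_hom, P.inner_F_K, map_add, inner_add_right, hp, hr, inner_zero_right]
  constructor
  · intro h
    field_simp
    linear_combination h
  · intro h
    field_simp at h
    linear_combination h

/-- Testing the equation for `w₂` with constants removes its left-hand side. The homogenized
equation is thus forced by the other equations of the cycle. -/
theorem CycleEqs.homEq (h : P.CycleEqs z s g p q r w₀ w₁ w₂) (hs : s ≠ 0) (hp : P.m p = 0)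
    (hr : P.m r = 0) : P.HomEq z s g p q r w₀ := by
  rw [h.eq_K]
  refine (solvable_iff_homEq hs hp hr _).1 fun a => ?_
  have h2 := h.two (P.K a)
  rw [P.D_K, inner_zero_left, inner_zero_left] at h2
  rw [← h.eq_K, ← h.eq_cor, h2]
  ring

variable (P z s) in
/-- The mean of the leading term, as a function of the data `(g, p, q, r)`, in terms of an inverse
`R` of `s⁻¹ • hom - z`. -/
noncomputable def leading (R : C →L[ℂ] C) : (L × W × W × W) →L[ℂ] C :=
  R ∘L (adjoint (P.F ∘L P.K) ∘L fst ℂ _ _ -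
    s⁻¹ • (adjoint (P.X ∘L P.K) ∘L P.M ∘L
      (P.D ∘L (fst ℂ _ _ ∘L snd ℂ _ _ ∘L snd ℂ _ _) +
        P.X ∘L (fst ℂ _ _ ∘L snd ℂ _ _ + snd ℂ _ _ ∘L snd ℂ _ _ ∘L snd ℂ _ _))))

theorem leading_iff {R : C →L[ℂ] C} (hR : ∀ a b, R a = b ↔ s⁻¹ • P.hom b - z • b = a) :
    P.m w₀ = P.leading s R (g, p, q, r) ↔ P.HomEq z s g p q r w₀ := by
  rw [eq_comm]
  simp only [leading, ContinuousLinearMap.comp_apply, hR, HomEq]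
  rw [ext_iff_inner_left ℂ]
  refine forall_congr' fun a => ?_
  simp only [add_apply, sub_apply, smul_apply, comp_apply, inner_sub_right, inner_smul_right,
    adjoint_inner_right, coe_fst', coe_snd']

variable (P z s) in
/-- The right-hand side of the second corrector problem as a function of the data. -/
noncomputable def load (R : C →L[ℂ] C) : (L × W × W × W) →L[ℂ] W :=
  let c := P.leading s R
  let p := fst ℂ W (W × W) ∘L snd ℂ L (W × W × W)
  let q := fst ℂ W W ∘L snd ℂ W (W × W) ∘L snd ℂ L (W × W × W)
  let r := snd ℂ W W ∘L snd ℂ W (W × W) ∘L snd ℂ L (W × W × W)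
  (z * s) • (adjoint P.F ∘L P.F ∘L (P.K ∘L c + p + r))
    + s • (adjoint P.F ∘L fst ℂ L (W × W × W))
    - adjoint P.D ∘L P.M ∘L P.X ∘L (P.cor ∘L c + q)
    - adjoint P.X ∘L P.M ∘L P.D ∘L (P.cor ∘L c + q)
    - adjoint P.X ∘L P.M ∘L P.X ∘L (P.K ∘L c + p + r)

theorem inner_load (R : C →L[ℂ] C) (v : W) :
    ⟪v, P.load z s R (g, p, q, r)⟫ =
      -⟪P.D v, P.M (P.X (P.cor (P.leading s R (g, p, q, r)) + q))⟫
      - ⟪P.X v, P.M (P.D (P.cor (P.leading s R (g, p, q, r)) + q))⟫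
      - ⟪P.X v, P.M (P.X (P.K (P.leading s R (g, p, q, r)) + p + r))⟫
      + z * s * ⟪P.F v, P.F (P.K (P.leading s R (g, p, q, r)) + p + r)⟫ + s * ⟪P.F v, g⟫ := by
  simp only [load, add_apply, sub_apply, smul_apply, comp_apply, inner_add_right,
    inner_sub_right, inner_smul_right, adjoint_inner_right, coe_fst', coe_snd']
  ring

/-- The system of one cycle is uniquely solvable, and the solution depends linearly and continuously
on the data. -/
theorem cycle_iff {R : C →L[ℂ] C} (hR : ∀ a b, R a = b ↔ s⁻¹ • P.hom b - z • b = a)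
    (hs : s ≠ 0) (hp : P.m p = 0) (hr : P.m r = 0) :
    (P.CycleEqs z s g p q r w₀ w₁ w₂ ∧ P.HomEq z s g p q r w₀) ↔
      w₀ = P.K (P.leading s R (g, p, q, r)) ∧ w₁ = P.cor (P.leading s R (g, p, q, r)) ∧
        w₂ = P.S (P.load z s R (g, p, q, r)) := by
  -- The constant `leading` solves the homogenized equation by construction, so the load of the
  -- second corrector problem annihilates the constants.
  have hload : ∀ a, ⟪P.K a, P.load z s R (g, p, q, r)⟫ = 0 := by
    intro a
    rw [inner_load, P.D_K, inner_zero_left, neg_zero, zero_sub]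
    exact ((solvable_iff_homEq hs hp hr _).2 ((leading_iff hR).1 (P.m_K _)) a).symm
  constructor
  · rintro ⟨h, h'⟩
    have h0 : P.m w₀ = P.leading s R (g, p, q, r) := (leading_iff hR).2 h'
    have hw₀ := h.eq_K
    have hw₁ := h.eq_cor
    rw [h0] at hw₀ hw₁
    refine ⟨hw₀, hw₁, P.eq_of_form_eq h.m_two (P.m_S hload) fun v => ?_⟩
    rw [P.form_S hload, h.two, inner_load, hw₀, hw₁]
  · rintro ⟨rfl, rfl, rfl⟩
    refine ⟨⟨fun v => ?_, fun v => ?_, P.m_cor _, fun v => ?_, P.m_S hload⟩,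
      (leading_iff hR).1 (P.m_K _)⟩
    · rw [P.D_K, map_zero, inner_zero_right]
    · exact P.form_cor _ v
    · rw [P.form_S hload, inner_load]

/-- Each term is the image of the data under a fixed bounded operator; the sum of the three operator
norms serves for all of them. -/
theorem cycle_bound {R : C →L[ℂ] C} (hR : ∀ a b, R a = b ↔ s⁻¹ • P.hom b - z • b = a)
    (hs : s ≠ 0) : ∃ B : ℝ, ∀ (g : L) (p q r w₀ w₁ w₂ : W), P.m p = 0 → P.m r = 0 →
      P.CycleEqs z s g p q r w₀ w₁ w₂ → P.HomEq z s g p q r w₀ →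
      ‖w₀‖ ≤ B * (‖g‖ + ‖p‖ + ‖q‖ + ‖r‖) ∧ ‖w₁‖ ≤ B * (‖g‖ + ‖p‖ + ‖q‖ + ‖r‖) ∧
        ‖w₂‖ ≤ B * (‖g‖ + ‖p‖ + ‖q‖ + ‖r‖) := by
  let A₀ := P.K ∘L P.leading s R
  let A₁ := P.cor ∘L P.leading s R
  let A₂ := P.S ∘L P.load z s R
  refine ⟨‖A₀‖ + ‖A₁‖ + ‖A₂‖, fun g p q r w₀ w₁ w₂ hp hr h h' => ?_⟩
  have hn : ‖((g, p, q, r) : L × W × W × W)‖ ≤ ‖g‖ + ‖p‖ + ‖q‖ + ‖r‖ := by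
    have h1 := norm_nonneg g
    have h2 := norm_nonneg p
    have h3 := norm_nonneg q
    have h4 := norm_nonneg r
    simp only [Prod.norm_def, max_le_iff]
    refine ⟨?_, ?_, ?_, ?_⟩ <;> linarith
  have key : ∀ A : (L × W × W × W) →L[ℂ] W, ‖A‖ ≤ ‖A₀‖ + ‖A₁‖ + ‖A₂‖ →
      ‖A (g, p, q, r)‖ ≤ (‖A₀‖ + ‖A₁‖ + ‖A₂‖) * (‖g‖ + ‖p‖ + ‖q‖ + ‖r‖) := fun A hA =>
    (A.le_opNorm _).trans (by gcongr)
  obtain ⟨e0, e1, e2⟩ := (cycle_iff hR hs hp hr).1 ⟨h, h'⟩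
  have a0 := norm_nonneg A₀
  have a1 := norm_nonneg A₁
  have a2 := norm_nonneg A₂
  exact ⟨e0 ▸ key A₀ (by linarith), e1 ▸ key A₁ (by linarith), e2 ▸ key A₂ (by linarith)⟩

variable (P) in
/-- The residual functional of the truncated expansion. -/
noncomputable def residual (z s : ℂ) (q w₁ w₂ v : W) : ℂ :=
  -⟪P.X v, P.M (P.X q)⟫ - ⟪P.X v, P.M (P.X w₁)⟫ - ⟪P.X v, P.M (P.D w₂)⟫ - ⟪P.D v, P.M (P.X w₂)⟫
    - ⟪P.X v, P.M (P.X w₂)⟫ + z * s * ⟪P.F v, P.F q⟫ + z * s * ⟪P.F v, P.F w₁⟫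
    + z * s * ⟪P.F v, P.F w₂⟫

/-- `U` stands for the error before the cycle, whose residual is built from `r`, `p`, `q`. The
equations for `w₁` and `w₂` cancel the load, the `p` and `r` terms and the mixed terms in `q`. The
term of `q` with two factors `X` and its mass term survive and enter the new residual, together with
what `w₁` and `w₂` leave over. -/
theorem CycleEqs.residual_step (h : P.CycleEqs z s g p q r w₀ w₁ w₂) (hs : s ≠ 0) {U : W}
    (hU : ∀ v, s⁻¹ * ⟪P.D v + P.X v, P.M (P.D U + P.X U)⟫ - z * ⟪P.F v, P.F U⟫ =
      ⟪P.F v, g⟫ + s⁻¹ * P.residual z s r p q v) (v : W) :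
    s⁻¹ * ⟪P.D v + P.X v, P.M (P.D (U - (w₀ + w₁ + w₂)) + P.X (U - (w₀ + w₁ + w₂)))⟫
      - z * ⟪P.F v, P.F (U - (w₀ + w₁ + w₂))⟫ = s⁻¹ * P.residual z s q w₁ w₂ v := by
  have h0 : P.D w₀ = 0 := by rw [h.eq_K, P.D_K]
  have h1 := h.one v
  have h2 := h.two v
  have hv := hU v
  simp only [residual, map_add, map_sub, inner_add_left, inner_add_right, inner_sub_right, h0,
    map_zero, inner_zero_right] at h1 h2 hv ⊢
  field_simp at hv ⊢
  linear_combination hv - h1 - h2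

end CellSystem

end Elasticity

noncomputable section

namespace Elasticity

local notation "⟪" x ", " y "⟫" => inner ℂ x y

/-! ### Multiplication by the coefficient tensor -/

/-- The action of a fourth-order tensor on matrices. -/
def applyTensor (A : Fin 3 → Fin 3 → Fin 3 → Fin 3 → ℝ) (B : Mat) : Mat :=
  WithLp.toLp 2 fun p => ∑ k, ∑ l, (A p.1 p.2 k l : ℂ) * B (k, l)

theorem inner_applyTensor (A : Fin 3 → Fin 3 → Fin 3 → Fin 3 → ℝ) (B H : Mat) :
    ⟪H, applyTensor A B⟫ =
      ∑ i, ∑ j, ∑ k, ∑ l, (A i j k l : ℂ) * B (k, l) * star (H (i, j)) := by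
  simp only [PiLp.inner_apply, applyTensor, Fintype.sum_prod_type, RCLike.inner_apply,
    Finset.sum_mul, starRingEnd_apply]

/-- A crude constant suffices: each entry is a sum of 9 products, and the Frobenius norm over 9
entries contributes a further factor 3. -/
theorem norm_applyTensor_le {A : Fin 3 → Fin 3 → Fin 3 → Fin 3 → ℝ} {C : ℝ} (hC : 0 ≤ C)
    (hA : ∀ i j k l, |A i j k l| ≤ C) (B : Mat) : ‖applyTensor A B‖ ≤ 27 * C * ‖B‖ := by
  have h1 : ∀ p, ‖applyTensor A B p‖ ≤ 9 * C * ‖B‖ := by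
    intro p
    calc ‖applyTensor A B p‖ ≤ ∑ k : Fin 3, ∑ l : Fin 3, C * ‖B‖ := by
          change ‖∑ k, ∑ l, (A p.1 p.2 k l : ℂ) * B (k, l)‖ ≤ _
          refine norm_sum_le_of_le _ fun k _ => norm_sum_le_of_le _ fun l _ => ?_
          rw [norm_mul, Complex.norm_real]
          exact mul_le_mul (hA _ _ _ _) (PiLp.norm_apply_le B _) (norm_nonneg _) hC
      _ = 9 * C * ‖B‖ := by simp; ring
  refine abs_le_of_sq_le_sq' ?_ (by positivity) |>.2
  rw [EuclideanSpace.norm_sq_eq]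
  calc ∑ p, ‖applyTensor A B p‖ ^ 2 ≤ ∑ _p : Fin 3 × Fin 3, (9 * C * ‖B‖) ^ 2 :=
        Finset.sum_le_sum fun p _ => pow_le_pow_left₀ (norm_nonneg _) (h1 p) 2
    _ = (27 * C * ‖B‖) ^ 2 := by simp; ring

/-- The coefficients are real, so the products of real with imaginary parts contribute only to the
imaginary part; ellipticity is applied to the real and imaginary parts of `B` separately. -/
theorem re_inner_applyTensor_ge {A : Fin 3 → Fin 3 → Fin 3 → Fin 3 → ℝ} {ν : ℝ}
    (hA : ∀ ξ : Matrix (Fin 3) (Fin 3) ℝ, ξ.IsSymm →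
      ν * (∑ i, ∑ j, ξ i j ^ 2) ≤ ∑ i, ∑ j, ∑ k, ∑ l, A i j k l * ξ k l * ξ i j)
    {B : Mat} (hB : ∀ i j, B (i, j) = B (j, i)) :
    ν * ‖B‖ ^ 2 ≤ RCLike.re ⟪B, applyTensor A B⟫ := by
  have h1 := hA (Matrix.of fun i j => (B (i, j)).re) (by ext i j; simp [hB i j])
  have h2 := hA (Matrix.of fun i j => (B (i, j)).im) (by ext i j; simp [hB i j])
  have e1 : ‖B‖ ^ 2 = ∑ i, ∑ j, (B (i, j)).re ^ 2 + ∑ i, ∑ j, (B (i, j)).im ^ 2 := by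
    rw [EuclideanSpace.norm_sq_eq, Fintype.sum_prod_type]
    simp only [← Finset.sum_add_distrib]
    refine Finset.sum_congr rfl fun i _ => Finset.sum_congr rfl fun j _ => ?_
    rw [Complex.sq_norm, Complex.normSq_apply]
    ring
  have e2 : RCLike.re ⟪B, applyTensor A B⟫ =
      ∑ i, ∑ j, ∑ k, ∑ l, A i j k l * (B (k, l)).re * (B (i, j)).re +
      ∑ i, ∑ j, ∑ k, ∑ l, A i j k l * (B (k, l)).im * (B (i, j)).im := by
    rw [inner_applyTensor]
    simp only [map_sum, ← Finset.sum_add_distrib]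
    refine Finset.sum_congr rfl fun i _ => Finset.sum_congr rfl fun j _ =>
      Finset.sum_congr rfl fun k _ => Finset.sum_congr rfl fun l _ => ?_
    simp
  rw [e1, e2, mul_add]
  exact add_le_add h1 h2

namespace IsElasticityTensor

variable {𝔸 : TensorField}

theorem exists_bound (h𝔸 : IsElasticityTensor 𝔸) :
    ∃ C : ℝ, 0 ≤ C ∧ ∀ᵐ y ∂cellMeasure, ∀ i j k l, |𝔸 y i j k l| ≤ C := by
  let N : Fin 3 → Fin 3 → Fin 3 → Fin 3 → ℝ := fun i j k l =>
    (eLpNorm (fun y => 𝔸 y i j k l) ⊤ cellMeasure).toReal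
  have hN : ∀ i j k l, 0 ≤ N i j k l := fun _ _ _ _ => ENNReal.toReal_nonneg
  refine ⟨∑ p : Fin 3 × Fin 3 × Fin 3 × Fin 3, N p.1 p.2.1 p.2.2.1 p.2.2.2,
    Finset.sum_nonneg fun _ _ => hN _ _ _ _, ?_⟩
  simp only [ae_all_iff]
  intro i j k l
  have h := ae_le_eLpNormEssSup (f := fun y => 𝔸 y i j k l) (μ := cellMeasure)
  filter_upwards [h] with y hy
  refine le_trans ?_ (Finset.single_le_sum
    (f := fun p : Fin 3 × Fin 3 × Fin 3 × Fin 3 => N p.1 p.2.1 p.2.2.1 p.2.2.2)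
    (fun _ _ => hN _ _ _ _) (Finset.mem_univ (i, j, k, l)))
  rw [← eLpNorm_exponent_top] at hy
  have h2 := ENNReal.toReal_mono (h𝔸.memLp_top i j k l).2.ne hy
  simpa [N] using h2

theorem memLp_applyTensor (h𝔸 : IsElasticityTensor 𝔸) (G : L2Mat) :
    MemLp (fun y => applyTensor (𝔸 y) (G y)) 2 cellMeasure := by
  obtain ⟨C, hC, hb⟩ := h𝔸.exists_bound
  refine MemLp.of_le_mul (c := 27 * C) (Lp.memLp G) ?_
    (hb.mono fun y hy => norm_applyTensor_le hC hy _)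
  refine AEMeasurable.aestronglyMeasurable ?_
  refine (PiLp.continuous_toLp 2 _).measurable.comp_aemeasurable (aemeasurable_pi_lambda _ fun p =>
    Finset.aemeasurable_fun_sum _ fun k _ => Finset.aemeasurable_fun_sum _ fun l _ => ?_)
  refine AEMeasurable.mul ?_ ?_
  · exact Complex.measurable_ofReal.comp_aemeasurable
      (h𝔸.memLp_top p.1 p.2 k l).1.aemeasurable
  · exact (EuclideanSpace.proj (𝕜 := ℂ) (k, l)).continuous.measurable.comp_aemeasurable
      (Lp.aestronglyMeasurable G).aemeasurable

/-- Multiplication by the coefficient tensor, as an operator on `L²(Y; ℂ^{3×3})`. -/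
def mulOp (h𝔸 : IsElasticityTensor 𝔸) : L2Mat →L[ℂ] L2Mat :=
  LinearMap.mkContinuous
    { toFun := fun G => (h𝔸.memLp_applyTensor G).toLp
      map_add' := fun G H => by
        rw [← MemLp.toLp_add]
        refine MemLp.toLp_congr _ _ ?_
        filter_upwards [Lp.coeFn_add G H] with y hy
        rw [hy]
        ext p
        simp [applyTensor, mul_add, Finset.sum_add_distrib]
      map_smul' := fun c G => by
        rw [RingHom.id_apply, ← MemLp.toLp_const_smul]
        refine MemLp.toLp_congr _ _ ?_
        filter_upwards [Lp.coeFn_smul c G] with y hy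
        rw [hy]
        ext p
        simp [applyTensor, Finset.mul_sum, mul_left_comm] }
    (27 * h𝔸.exists_bound.choose) fun G => by
      refine Lp.norm_le_mul_norm_of_ae_le_mul ?_
      filter_upwards [h𝔸.exists_bound.choose_spec.2, (h𝔸.memLp_applyTensor G).coeFn_toLp]
        with y hy h
      exact h ▸ norm_applyTensor_le h𝔸.exists_bound.choose_spec.1 hy _

theorem coeFn_mulOp (h𝔸 : IsElasticityTensor 𝔸) (G : L2Mat) :
    h𝔸.mulOp G =ᵐ[cellMeasure] fun y => applyTensor (𝔸 y) (G y) :=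
  (h𝔸.memLp_applyTensor G).coeFn_toLp

/-- The bridge from the integrals to the Hilbert space formulation. The inner product is
conjugate-linear in its first slot, so the test field moves to the left. -/
theorem energy_eq_inner (h𝔸 : IsElasticityTensor 𝔸) {G H : (Fin 3 → ℝ) → Mat} {G' H' : L2Mat}
    (hG : G' =ᵐ[cellMeasure] G) (hH : H' =ᵐ[cellMeasure] H) :
    energy 𝔸 G H = ⟪H', h𝔸.mulOp G'⟫ := by
  rw [L2.inner_def, energy]
  refine integral_congr_ae ?_
  filter_upwards [hG, hH, h𝔸.coeFn_mulOp G'] with y h1 h2 h3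
  rw [h3, inner_applyTensor, h1, h2]

theorem re_inner_mulOp_ge (h𝔸 : IsElasticityTensor 𝔸) : ∃ ν : ℝ, 0 < ν ∧ ∀ B : L2Mat,
    (∀ᵐ y ∂cellMeasure, ∀ i j, B y (i, j) = B y (j, i)) →
      ν * ‖B‖ ^ 2 ≤ RCLike.re ⟪B, h𝔸.mulOp B⟫ := by
  obtain ⟨ν, hν, h⟩ := h𝔸.elliptic
  refine ⟨ν, hν, fun B hB => ?_⟩
  have h1 : ‖B‖ ^ 2 = ∫ y, ‖B y‖ ^ 2 ∂cellMeasure := by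
    rw [← inner_self_eq_norm_sq (𝕜 := ℂ), L2.inner_def, ← integral_re (L2.integrable_inner B B)]
    simp only [inner_self_eq_norm_sq]
  have hi : Integrable (fun y => ‖B y‖ ^ 2) cellMeasure := (Lp.memLp B).integrable_norm_pow two_ne_zero
  rw [h1, L2.inner_def, ← integral_re (L2.integrable_inner _ _), ← integral_const_mul]
  refine integral_mono_ae (hi.const_mul ν) (L2.integrable_inner (𝕜 := ℂ) B (h𝔸.mulOp B)).re ?_
  -- Ellipticity is assumed only at points of the cell, hence the membership statement.
  filter_upwards [hB, h𝔸.coeFn_mulOp B, ae_restrict_mem measurableSet_cell] with y h2 h3 h4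
  rw [h3]
  exact re_inner_applyTensor_ge (fun ξ hξ => (h y h4 ξ hξ).1) h2

end IsElasticityTensor

/-! ### The operators on the periodic Sobolev space -/

/-- The symmetric part as a continuous linear map. -/
def symPartL : Mat →L[ℂ] Mat :=
  LinearMap.toContinuousLinearMap
    { toFun := symPart
      map_add' := fun A B => by ext p; simp [symPart]; ring
      map_smul' := fun c A => by ext p; simp [symPart]; ring }

/-- The map `c ↦ i X_χ c` as a continuous linear map. -/
def iXL (χ : EuclideanSpace ℝ (Fin 3)) : Vec →L[ℂ] Mat :=
  LinearMap.toContinuousLinearMap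
    { toFun := iX χ
      map_add' := fun a b => by ext p; simp [iX, symPart]; ring
      map_smul' := fun c a => by ext p; simp [iX, symPart]; ring }

/-- The underlying function, as a continuous linear map on `H¹_#`. -/
def fnL : H1per →L[ℂ] L2Vec :=
  WithLp.fstL 2 ℂ L2Vec L2Mat ∘L smoothPeriodic.topologicalClosure.subtypeL

/-- The gradient, as a continuous linear map on `H¹_#`. -/
def gradL : H1per →L[ℂ] L2Mat :=
  WithLp.sndL 2 ℂ L2Vec L2Mat ∘L smoothPeriodic.topologicalClosure.subtypeL

/-- The symmetrized gradient, as a continuous linear map on `H¹_#`. -/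
def symGradL : H1per →L[ℂ] L2Mat := symPartL.compLpL 2 cellMeasure ∘L gradL

/-- The operator `i X_χ` on `H¹_#`. -/
def iXfnL (χ : EuclideanSpace ℝ (Fin 3)) : H1per →L[ℂ] L2Mat :=
  (iXL χ).compLpL 2 cellMeasure ∘L fnL

theorem coeFn_symGradL (w : H1per) : symGradL w =ᵐ[cellMeasure] symGrad w :=
  ContinuousLinearMap.coeFn_compLpL symPartL w.1.snd

theorem coeFn_iXfnL (χ : EuclideanSpace ℝ (Fin 3)) (w : H1per) :
    iXfnL χ w =ᵐ[cellMeasure] iXfn χ w :=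
  ContinuousLinearMap.coeFn_compLpL (iXL χ) (fn w)

theorem gradient_const (c : Vec) : gradient (fun _ => c) = 0 := by
  funext y
  ext p
  simp [gradient]

theorem mem_smoothPeriodic_const (c : Vec) :
    WithLp.toLp 2 (Lp.constL 2 cellMeasure ℂ c, (0 : L2Mat)) ∈ smoothPeriodic.topologicalClosure :=
  Submodule.le_topologicalClosure _ ⟨fun _ => c, ⟨contDiff_const, fun _ _ => rfl⟩,
    Lp.coeFn_const 2 cellMeasure c, by
      rw [gradient_const]
      exact Lp.coeFn_zero _ _ _⟩

/-- The inclusion of the constants in `H¹_#`. -/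
def constH1 : Vec →L[ℂ] H1per :=
  LinearMap.toContinuousLinearMap
    { toFun := fun c => ⟨_, mem_smoothPeriodic_const c⟩
      map_add' := fun a b => by
        refine Subtype.ext (WithLp.ofLp_injective 2 (Prod.ext ?_ ?_)) <;> simp
      map_smul' := fun c a => by
        refine Subtype.ext (WithLp.ofLp_injective 2 (Prod.ext ?_ ?_)) <;> simp }

theorem symGradL_constH1 (c : Vec) : symGradL (constH1 c) = 0 :=
  map_zero (symPartL.compLpL 2 cellMeasure)

/-- It exhibits the mean as the adjoint of the inclusion of the constants, which yields its
linearity and continuity at once. -/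
theorem inner_constL (c : Vec) (u : L2Vec) :
    ⟪Lp.constL 2 cellMeasure ℂ c, u⟫ = ⟪c, ∫ y, u y ∂cellMeasure⟫ := by
  rw [L2.inner_def, ← integral_inner ((Lp.memLp u).integrable one_le_two)]
  refine integral_congr_ae ?_
  filter_upwards [Lp.coeFn_const 2 cellMeasure c] with y hy
  exact congrArg (fun x => ⟪x, u y⟫) hy

/-- The mean, as a continuous linear map on `H¹_#`. -/
def meanL : H1per →L[ℂ] Vec :=
  ContinuousLinearMap.adjoint (Lp.constL 2 cellMeasure ℂ) ∘L fnL

theorem meanL_apply (w : H1per) : meanL w = mean w := by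
  refine ext_inner_left ℂ fun c => ?_
  rw [meanL, ContinuousLinearMap.comp_apply, ContinuousLinearMap.adjoint_inner_right, inner_constL]
  rfl

theorem mean_constH1 (c : Vec) : mean (constH1 c) = c := by
  have h : ∫ y, fn (constH1 c) y ∂cellMeasure = ∫ _, c ∂cellMeasure :=
    integral_congr_ae (Lp.coeFn_const 2 cellMeasure c)
  rw [mean, h]
  simp

/-! ### The Korn and Poincaré inequalities -/

namespace IsSmoothPeriodic

variable {φ : (Fin 3 → ℝ) → Vec}

theorem component (hφ : IsSmoothPeriodic φ) (i : Fin 3) :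
    SmoothPeriodicScalar (fun y => φ y i) :=
  ⟨((EuclideanSpace.proj (𝕜 := ℂ) i).restrictScalars ℝ).contDiff.comp hφ.1,
    fun y a => by simp only [hφ.2]⟩

theorem gradient_apply (hφ : IsSmoothPeriodic φ) (y : Fin 3 → ℝ) (i j : Fin 3) :
    gradient φ y (i, j) = partialDeriv j (fun y => φ y i) y := by
  have h := ((EuclideanSpace.proj (𝕜 := ℂ) i : Vec →L[ℂ] ℂ).restrictScalars ℝ).hasFDerivAt.comp y
    (hφ.1.differentiable (by simp) y).hasFDerivAt
  have h2 : fderiv ℝ (fun y => φ y i) y = _ := h.fderiv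
  simp [gradient, partialDeriv, h2]

end IsSmoothPeriodic

theorem norm_sq_eq_integral {ι : Type*} [Fintype ι]
    {u : Lp (EuclideanSpace ℂ ι) 2 cellMeasure} {f : (Fin 3 → ℝ) → EuclideanSpace ℂ ι}
    (h : u =ᵐ[cellMeasure] f) : ‖u‖ ^ 2 = ∫ y, ∑ i, ‖f y i‖ ^ 2 ∂cellMeasure := by
  rw [← inner_self_eq_norm_sq (𝕜 := ℂ), L2.inner_def, ← integral_re (L2.integrable_inner u u)]
  refine integral_congr_ae (h.mono fun y hy => ?_)
  simp only [inner_self_eq_norm_sq, hy, EuclideanSpace.norm_sq_eq]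

/-- The scalar Poincaré inequality summed over components. The mean is written as an adjoint so that
both sides are continuous on the product space and the inequality passes to the closure. -/
theorem norm_sq_fst_le_of_mem_smoothPeriodic {w : WithLp 2 (L2Vec × L2Mat)}
    (hw : w ∈ smoothPeriodic) :
    ‖w.fst‖ ^ 2 ≤ ‖ContinuousLinearMap.adjoint (Lp.constL 2 cellMeasure ℂ) w.fst‖ ^ 2
      + ‖w.snd‖ ^ 2 := by
  obtain ⟨φ, hφ, h1, h2⟩ := hw
  have hm : ContinuousLinearMap.adjoint (Lp.constL 2 cellMeasure ℂ) w.fst =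
      ∫ y, φ y ∂cellMeasure := by
    refine ext_inner_left ℂ fun c => ?_
    rw [ContinuousLinearMap.adjoint_inner_right, inner_constL, integral_congr_ae h1]
  have hi : ∀ i, Continuous fun y => ‖φ y i‖ ^ 2 := fun i =>
    ((hφ.component i).continuous.norm.pow 2)
  have hd : ∀ p : Fin 3 × Fin 3, Continuous fun y => ‖gradient φ y p‖ ^ 2 := fun p => by
    simp only [hφ.gradient_apply]
    exact ((hφ.component p.1).partialDeriv p.2).continuous.norm.pow 2
  have hmi : ∀ i, (∫ y, φ y ∂cellMeasure) i = ∫ y, φ y i ∂cellMeasure := fun i =>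
    ((EuclideanSpace.proj (𝕜 := ℂ) i : Vec →L[ℂ] ℂ).integral_comp_comm
      (integrable_of_continuous hφ.1.continuous)).symm
  rw [hm, norm_sq_eq_integral h1, norm_sq_eq_integral h2, EuclideanSpace.norm_sq_eq,
    integral_finsetSum _ fun i _ => integrable_of_continuous (hi i),
    integral_finsetSum _ fun p _ => integrable_of_continuous (hd p), Fintype.sum_prod_type,
    ← Finset.sum_add_distrib]
  refine Finset.sum_le_sum fun i _ => ?_
  simp only [hφ.gradient_apply, hmi]
  exact integral_sq_le_of_smoothPeriodicScalar (hφ.component i)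

/-- Expansion of `|B + Bᵀ|²`; for periodic gradients the cross term has nonnegative integral. -/
theorem two_mul_norm_sq_symPart (B : Mat) :
    2 * ∑ p, ‖symPart B p‖ ^ 2 =
      ∑ p, ‖B p‖ ^ 2 + (∑ i, ∑ j, B (i, j) * star (B (j, i))).re := by
  have h1 : ∑ p, ‖B p‖ ^ 2 = ∑ i, ∑ j, (‖B (i, j)‖ ^ 2 + ‖B (j, i)‖ ^ 2) / 2 := by
    simp only [add_div, Finset.sum_add_distrib]
    rw [Finset.sum_comm (f := fun i j => ‖B (j, i)‖ ^ 2 / 2)]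
    simp only [← Finset.sum_add_distrib, add_halves, Fintype.sum_prod_type]
  rw [h1, Complex.re_sum, Fintype.sum_prod_type, Finset.mul_sum, ← Finset.sum_add_distrib]
  refine Finset.sum_congr rfl fun i _ => ?_
  rw [Complex.re_sum, Finset.mul_sum, ← Finset.sum_add_distrib]
  refine Finset.sum_congr rfl fun j _ => ?_
  simp only [symPart, Complex.sq_norm, Complex.normSq_apply]
  simp
  ring

theorem norm_sq_snd_le_of_mem_smoothPeriodic {w : WithLp 2 (L2Vec × L2Mat)}
    (hw : w ∈ smoothPeriodic) :
    ‖w.snd‖ ^ 2 ≤ 2 * ‖symPartL.compLpL 2 cellMeasure w.snd‖ ^ 2 := by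
  obtain ⟨φ, hφ, -, h2⟩ := hw
  have hs : symPartL.compLpL 2 cellMeasure w.snd =ᵐ[cellMeasure] fun y => symPart (gradient φ y) :=
    (ContinuousLinearMap.coeFn_compLpL symPartL w.snd).trans
      (h2.mono fun y hy => congrArg symPart hy)
  have hc : ∀ i j, Continuous fun y => gradient φ y (i, j) := fun i j => by
    simp only [hφ.gradient_apply]
    exact ((hφ.component i).partialDeriv j).continuous
  have hprod : ∀ i j k l, Integrable
      (fun y => gradient φ y (i, j) * star (gradient φ y (k, l))) cellMeasure := fun i j k l =>
    integrable_of_continuous ((hc i j).mul (continuous_star.comp (hc k l)))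
  have hsq : Integrable (fun y => ∑ p, ‖gradient φ y p‖ ^ 2) cellMeasure :=
    integrable_finsetSum _ fun p _ => integrable_of_continuous ((hc p.1 p.2).norm.pow 2)
  have hcross : Integrable
      (fun y => ∑ i, ∑ j, gradient φ y (i, j) * star (gradient φ y (j, i))) cellMeasure :=
    integrable_finsetSum _ fun i _ => integrable_finsetSum _ fun j _ => hprod _ _ _ _
  rw [norm_sq_eq_integral h2, norm_sq_eq_integral hs, ← integral_const_mul]
  simp only [two_mul_norm_sq_symPart]
  have hcross_re := hcross.re
  simp only [RCLike.re_eq_complex_re] at hcross_re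
  rw [integral_add hsq hcross_re, le_add_iff_nonneg_right]
  -- Exchanging the two derivatives by integration by parts turns `∫ ∇φ : conj (∇φ)ᵀ` into `∫ |div
  -- φ|²`, so the cross term can be discarded.
  have hdiv : ∫ y, ∑ i, ∑ j, gradient φ y (i, j) * star (gradient φ y (j, i)) ∂cellMeasure =
      ∫ y, ((‖∑ i, gradient φ y (i, i)‖ ^ 2 : ℝ) : ℂ) ∂cellMeasure := by
    have h3 : ∀ y, ((‖∑ i, gradient φ y (i, i)‖ ^ 2 : ℝ) : ℂ) =
        ∑ i, ∑ j, gradient φ y (i, i) * star (gradient φ y (j, j)) := by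
      intro y
      rw [← Finset.sum_mul_sum, ← star_sum]
      push_cast
      exact (Complex.mul_conj' _).symm
    simp only [h3]
    have hsum : ∀ f : Fin 3 → Fin 3 → (Fin 3 → ℝ) → ℂ, (∀ i j, Integrable (f i j) cellMeasure) →
        ∫ y, ∑ i, ∑ j, f i j y ∂cellMeasure = ∑ i, ∑ j, ∫ y, f i j y ∂cellMeasure := by
      intro f hf
      rw [integral_finsetSum _ fun i _ => integrable_finsetSum _ fun j _ => hf i j]
      exact Finset.sum_congr rfl fun i _ => integral_finsetSum _ fun j _ => hf i j
    rw [hsum _ fun i j => hprod i j j i, hsum _ fun i j => hprod i i j j]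
    refine Finset.sum_congr rfl fun i _ => Finset.sum_congr rfl fun j _ => ?_
    simp only [hφ.gradient_apply]
    exact integral_partialDeriv_mul_star_comm (hφ.component i) (hφ.component j) i j
  have hre := integral_re hcross
  simp only [RCLike.re_eq_complex_re] at hre
  rw [hre, hdiv, integral_complex_ofReal, Complex.ofReal_re]
  exact integral_nonneg fun y => by positivity

/-- The Poincaré inequality on `H¹_#`. -/
theorem norm_sq_fnL_le (w : H1per) : ‖fnL w‖ ^ 2 ≤ ‖mean w‖ ^ 2 + ‖gradL w‖ ^ 2 := by
  rw [← meanL_apply]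
  have hcl : IsClosed {w : WithLp 2 (L2Vec × L2Mat) | ‖WithLp.fstL 2 ℂ L2Vec L2Mat w‖ ^ 2 ≤
      ‖ContinuousLinearMap.adjoint (Lp.constL 2 cellMeasure ℂ) (WithLp.fstL 2 ℂ L2Vec L2Mat w)‖ ^ 2
      + ‖WithLp.sndL 2 ℂ L2Vec L2Mat w‖ ^ 2} :=
    isClosed_le (by fun_prop) (by fun_prop)
  exact closure_minimal (fun _ h => norm_sq_fst_le_of_mem_smoothPeriodic h) hcl w.2

/-- The Korn inequality on `H¹_#`. -/
theorem norm_sq_gradL_le (w : H1per) : ‖gradL w‖ ^ 2 ≤ 2 * ‖symGradL w‖ ^ 2 := by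
  have hcl : IsClosed {w : WithLp 2 (L2Vec × L2Mat) | ‖WithLp.sndL 2 ℂ L2Vec L2Mat w‖ ^ 2 ≤
      2 * ‖symPartL.compLpL 2 cellMeasure (WithLp.sndL 2 ℂ L2Vec L2Mat w)‖ ^ 2} :=
    isClosed_le (by fun_prop) (by fun_prop)
  exact closure_minimal (fun _ h => norm_sq_snd_le_of_mem_smoothPeriodic h) hcl w.2

theorem norm_sq_eq_add (w : H1per) : ‖w‖ ^ 2 = ‖fnL w‖ ^ 2 + ‖gradL w‖ ^ 2 :=
  WithLp.prod_norm_sq_eq_of_L2 w.1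

/-- The cell system of periodic elasticity. -/
def cellSystem {𝔸 : TensorField} (h𝔸 : IsElasticityTensor 𝔸) (χ : EuclideanSpace ℝ (Fin 3)) :
    CellSystem H1per L2Mat L2Vec Vec where
  D := symGradL
  X := iXfnL χ
  M := h𝔸.mulOp
  F := fnL
  K := constH1
  m := meanL
  m_K a := by rw [meanL_apply, mean_constH1]
  D_K := symGradL_constH1
  inner_F_K a w := by
    rw [meanL_apply]
    exact inner_constL a (fn w)
  coercive := by
    obtain ⟨ν, hν, h⟩ := h𝔸.re_inner_mulOp_ge
    -- At mean zero, Poincaré bounds `‖w‖²` by twice the squared gradient norm, and Korn bounds the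
    -- latter by twice the squared strain norm; the factor 4 is their product.
    refine ⟨ν / 4, by positivity, fun w hw => le_trans ?_ (h (symGradL w) ?_)⟩
    · rw [meanL_apply] at hw
      have h1 := norm_sq_fnL_le w
      have h2 := norm_sq_gradL_le w
      rw [hw, norm_zero] at h1
      rw [norm_sq_eq_add]
      nlinarith
    · filter_upwards [coeFn_symGradL w] with y hy i j
      rw [hy]
      simp [symGrad, symPart, add_comm]

/-! ### The forms as inner products -/

section Forms

theorem mass_eq_inner {u v : (Fin 3 → ℝ) → Vec} {u' v' : L2Vec} (hu : u' =ᵐ[cellMeasure] u)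
    (hv : v' =ᵐ[cellMeasure] v) : mass u v = ⟪v', u'⟫ := by
  rw [L2.inner_def, mass]
  refine integral_congr_ae ?_
  filter_upwards [hu, hv] with y h1 h2
  rw [h1, h2, PiLp.inner_apply]
  rfl

variable {𝔸 : TensorField} (h𝔸 : IsElasticityTensor 𝔸) (χ : EuclideanSpace ℝ (Fin 3))

theorem mass_fn (g : L2Vec) (v : H1per) : mass g (fn v) = ⟪(cellSystem h𝔸 χ).F v, g⟫ :=
  mass_eq_inner (.refl _ _) (.refl _ _)

theorem mass_const (g : L2Vec) (a : Vec) :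
    mass g (fun _ => a) = ⟪(cellSystem h𝔸 χ).F ((cellSystem h𝔸 χ).K a), g⟫ :=
  mass_eq_inner (.refl _ _) (Lp.coeFn_const 2 cellMeasure a)

theorem mass_fn_const (u : H1per) (a : Vec) :
    mass (fn u) (fun _ => a) = ⟪a, (cellSystem h𝔸 χ).m u⟫ := by
  rw [← (cellSystem h𝔸 χ).inner_F_K]
  exact mass_const h𝔸 χ _ a

theorem coeFn_add_of_ae {u v : L2Mat} {f g : (Fin 3 → ℝ) → Mat} (hu : u =ᵐ[cellMeasure] f)
    (hv : v =ᵐ[cellMeasure] g) : ((u + v : L2Mat) : (Fin 3 → ℝ) → Mat) =ᵐ[cellMeasure] f + g :=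
  (Lp.coeFn_add u v).trans (hu.add hv)

theorem coeFn_iXfnL_constH1 (a : Vec) :
    iXfnL χ (constH1 a) =ᵐ[cellMeasure] fun _ => iX χ a :=
  (coeFn_iXfnL χ _).trans
    ((Lp.coeFn_const 2 cellMeasure a).mono fun _ hy => congrArg (iX χ) hy)

theorem energy_symGrad_symGrad (w v : H1per) : energy 𝔸 (symGrad w) (symGrad v) =
    ⟪(cellSystem h𝔸 χ).D v, (cellSystem h𝔸 χ).M ((cellSystem h𝔸 χ).D w)⟫ :=
  h𝔸.energy_eq_inner (coeFn_symGradL w) (coeFn_symGradL v)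

theorem energy_iXfn_symGrad (w v : H1per) : energy 𝔸 (iXfn χ w) (symGrad v) =
    ⟪(cellSystem h𝔸 χ).D v, (cellSystem h𝔸 χ).M ((cellSystem h𝔸 χ).X w)⟫ :=
  h𝔸.energy_eq_inner (coeFn_iXfnL χ w) (coeFn_symGradL v)

theorem energy_symGrad_iXfn (w v : H1per) : energy 𝔸 (symGrad w) (iXfn χ v) =
    ⟪(cellSystem h𝔸 χ).X v, (cellSystem h𝔸 χ).M ((cellSystem h𝔸 χ).D w)⟫ :=
  h𝔸.energy_eq_inner (coeFn_symGradL w) (coeFn_iXfnL χ v)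

theorem energy_iXfn_iXfn (w v : H1per) : energy 𝔸 (iXfn χ w) (iXfn χ v) =
    ⟪(cellSystem h𝔸 χ).X v, (cellSystem h𝔸 χ).M ((cellSystem h𝔸 χ).X w)⟫ :=
  h𝔸.energy_eq_inner (coeFn_iXfnL χ w) (coeFn_iXfnL χ v)

theorem energy_add_iX (w p : H1per) (a : Vec) :
    energy 𝔸 (symGrad w + iXfn χ p) (fun _ => iX χ a) =
      ⟪(cellSystem h𝔸 χ).X ((cellSystem h𝔸 χ).K a),
        (cellSystem h𝔸 χ).M ((cellSystem h𝔸 χ).D w + (cellSystem h𝔸 χ).X p)⟫ :=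
  h𝔸.energy_eq_inner (coeFn_add_of_ae (coeFn_symGradL w) (coeFn_iXfnL χ p))
    (coeFn_iXfnL_constH1 χ a)

theorem energy_add_const_symGrad (w v : H1per) (c : Vec) :
    energy 𝔸 (symGrad w + fun _ => iX χ c) (symGrad v) =
      ⟪(cellSystem h𝔸 χ).D v, (cellSystem h𝔸 χ).M ((cellSystem h𝔸 χ).D w +
        (cellSystem h𝔸 χ).X ((cellSystem h𝔸 χ).K c))⟫ :=
  h𝔸.energy_eq_inner (coeFn_add_of_ae (coeFn_symGradL w) (coeFn_iXfnL_constH1 χ c))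
    (coeFn_symGradL v)

theorem energy_add_const_iX (w : H1per) (c d : Vec) :
    energy 𝔸 (symGrad w + fun _ => iX χ c) (fun _ => iX χ d) =
      ⟪(cellSystem h𝔸 χ).X ((cellSystem h𝔸 χ).K d), (cellSystem h𝔸 χ).M
        ((cellSystem h𝔸 χ).D w + (cellSystem h𝔸 χ).X ((cellSystem h𝔸 χ).K c))⟫ :=
  h𝔸.energy_eq_inner (coeFn_add_of_ae (coeFn_symGradL w) (coeFn_iXfnL_constH1 χ c))
    (coeFn_iXfnL_constH1 χ d)

theorem fiberForm_eq_inner (u v : H1per) : fiberForm 𝔸 χ u v =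
    ⟪(cellSystem h𝔸 χ).D v + (cellSystem h𝔸 χ).X v,
      (cellSystem h𝔸 χ).M ((cellSystem h𝔸 χ).D u + (cellSystem h𝔸 χ).X u)⟫ :=
  h𝔸.energy_eq_inner (coeFn_add_of_ae (coeFn_symGradL u) (coeFn_iXfnL χ u))
    (coeFn_add_of_ae (coeFn_symGradL v) (coeFn_iXfnL χ v))

theorem m_eq_mean (w : H1per) : (cellSystem h𝔸 χ).m w = mean w := meanL_apply w

/-! ### The corrector and the homogenized matrix -/

theorem isCorrector_iff (c : Vec) (w : H1per) :
    IsCorrector 𝔸 χ c w ↔ w = (cellSystem h𝔸 χ).cor c := by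
  simp only [IsCorrector, energy_add_const_symGrad h𝔸, ← m_eq_mean h𝔸 χ, map_add, inner_add_right,
    add_eq_zero_iff_eq_neg]
  exact ⟨fun h => (cellSystem h𝔸 χ).eq_cor h.2 h.1,
    fun h => h ▸ ⟨(cellSystem h𝔸 χ).form_cor c, (cellSystem h𝔸 χ).m_cor c⟩⟩

theorem corrector_eq (c : Vec) : corrector 𝔸 χ c = (cellSystem h𝔸 χ).cor c := by
  have h : ∃ w, IsCorrector 𝔸 χ c w := ⟨_, (isCorrector_iff h𝔸 χ c _).2 rfl⟩
  rw [corrector, dif_pos h]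
  exact (isCorrector_iff h𝔸 χ c _).1 h.choose_spec

theorem homForm_eq_inner (c d : Vec) : homForm 𝔸 χ c d = ⟪d, (cellSystem h𝔸 χ).hom c⟫ := by
  rw [homForm, energy_add_const_iX h𝔸, corrector_eq h𝔸, (cellSystem h𝔸 χ).inner_hom]

/-- Correctors depend linearly on `c`, so the entries read off on basis vectors determine the
operator. -/
theorem homMatrix_mulVec (c : Vec) :
    homMatrix 𝔸 χ *ᵥ WithLp.ofLp c = WithLp.ofLp ((cellSystem h𝔸 χ).hom c) := by
  funext i
  have hc : c = ∑ j, c j • EuclideanSpace.single j (1 : ℂ) := by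
    ext k
    simp [Pi.single_apply]
  conv_rhs => rw [hc]
  simp only [Matrix.mulVec, dotProduct, homMatrix, Matrix.of_apply, homForm_eq_inner h𝔸,
    EuclideanSpace.inner_single_left, map_one, one_mul, map_sum, map_smul]
  simp [mul_comm]

theorem homPairing_eq_inner (c d : Vec) :
    homPairing 𝔸 χ c d = ⟪d, (cellSystem h𝔸 χ).hom c⟫ := by
  simp only [homPairing, homMatrix_mulVec h𝔸, PiLp.inner_apply]
  rfl

variable {χ} in
theorem exists_resolvent {z : ℂ}
    (hz : z ∈ resolventSet ℂ (((‖χ‖ : ℂ) ^ 2)⁻¹ • homMatrix 𝔸 χ)) :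
    ∃ R : Vec →L[ℂ] Vec, ∀ a b, R a = b ↔
      ((‖χ‖ : ℂ) ^ 2)⁻¹ • (cellSystem h𝔸 χ).hom b - z • b = a := by
  have hA : Matrix.toEuclideanCLM (𝕜 := ℂ) (homMatrix 𝔸 χ) = (cellSystem h𝔸 χ).hom := by
    ext1 c
    refine WithLp.ofLp_injective 2 ?_
    rw [← homMatrix_mulVec]
    rfl
  have hu := (spectrum.mem_resolventSet_iff.1 hz).map (Matrix.toEuclideanCLM (n := Fin 3) (𝕜 := ℂ))
  obtain ⟨T, hT⟩ := hu
  have hTb : ∀ b, (T : Vec →L[ℂ] Vec) b = z • b - ((‖χ‖ : ℂ) ^ 2)⁻¹ • (cellSystem h𝔸 χ).hom b := by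
    intro b
    rw [hT, map_sub, map_smul, hA, Algebra.algebraMap_eq_smul_one, map_smul, map_one]
    rfl
  have h1 : ∀ a, (T : Vec →L[ℂ] Vec) ((↑T⁻¹ : Vec →L[ℂ] Vec) a) = a := fun a => by
    rw [← mul_apply_eq_comp, T.mul_inv]; rfl
  have h2 : ∀ a, (↑T⁻¹ : Vec →L[ℂ] Vec) ((T : Vec →L[ℂ] Vec) a) = a := fun a => by
    rw [← mul_apply_eq_comp, T.inv_mul]; rfl
  -- The resolvent set concerns `z - A`, while the homogenized equation contains `A - z`; hence the
  -- sign.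
  refine ⟨-(↑T⁻¹ : Vec →L[ℂ] Vec), fun a b => ?_⟩
  rw [← neg_sub, ← hTb]
  constructor
  · rintro rfl
    simp [h1]
  · rintro rfl
    simp [h2]

/-! ### The cycle problems -/

theorem cycleProblem_iff {z : ℂ} {g : L2Vec} {p q r : H1per} {w : Fin 3 → H1per} :
    CycleProblem 𝔸 χ z g p q r w ↔
      (cellSystem h𝔸 χ).CycleEqs z ((‖χ‖ : ℂ) ^ 2) g p q r (w 0) (w 1) (w 2) ∧
        (cellSystem h𝔸 χ).HomEq z ((‖χ‖ : ℂ) ^ 2) g p q r (w 0) := by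
  constructor
  · rintro ⟨h1, h2, h3, h4, h5, h6⟩
    simp only [energy_symGrad_symGrad h𝔸 χ, energy_iXfn_symGrad h𝔸, energy_symGrad_iXfn h𝔸,
      energy_iXfn_iXfn h𝔸, mass_fn h𝔸 χ, ← m_eq_mean h𝔸 χ] at h1 h2 h3 h4 h5
    simp only [homPairing_eq_inner h𝔸, mass_fn_const h𝔸 χ, mass_const h𝔸 χ, energy_add_iX h𝔸,
      ← m_eq_mean h𝔸 χ] at h6
    exact ⟨⟨h1, h2, h3, h4, h5⟩, h6⟩
  · rintro ⟨⟨h1, h2, h3, h4, h5⟩, h6⟩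
    constructor
    all_goals simp only [energy_symGrad_symGrad h𝔸 χ, energy_iXfn_symGrad h𝔸,
      energy_symGrad_iXfn h𝔸, energy_iXfn_iXfn h𝔸, homPairing_eq_inner h𝔸, mass_fn_const h𝔸 χ,
      mass_const h𝔸 χ, energy_add_iX h𝔸, mass_fn h𝔸 χ, ← m_eq_mean h𝔸 χ]
    · exact h1
    · exact h2
    · exact h3
    · exact h4
    · exact h5
    · exact h6

end Forms

/-! ### The asymptotic procedure -/

/-- The sequence `x` delayed by one step. -/
def delay {W : Type*} [Zero W] (x : ℕ → W) : ℕ → W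
  | 0 => 0
  | n + 1 => x n

theorem delay_congr {W : Type*} [Zero W] {x y : ℕ → W} {n : ℕ} (h : ∀ k < n, x k = y k) :
    delay x n = delay y n := by
  cases n with
  | zero => rfl
  | succ n => exact h n n.lt_succ_self

/-- The load of the cycles: `f` in cycle `0` and `0` afterwards. -/
def cycleLoad (f : L2Vec) : ℕ → L2Vec
  | 0 => f
  | _ + 1 => 0

/-! ### Bookkeeping of the orders in the expansion -/

section Orders

variable (𝔸 : TensorField) (χ : EuclideanSpace ℝ (Fin 3)) (z : ℂ)

/-- The contribution to the resolvent equation whose order is lower by two than that of `w`. -/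
def lowTerm (w v : H1per) : ℂ := ((‖χ‖ : ℂ) ^ 2)⁻¹ * energy 𝔸 (symGrad w) (symGrad v)

/-- The contribution to the resolvent equation whose order is lower by one than that of `w`. -/
def midTerm (w v : H1per) : ℂ :=
  ((‖χ‖ : ℂ) ^ 2)⁻¹ * (energy 𝔸 (symGrad w) (iXfn χ v) + energy 𝔸 (iXfn χ w) (symGrad v))

/-- The contribution to the resolvent equation whose order is that of `w`. -/
def topTerm (w v : H1per) : ℂ :=
  ((‖χ‖ : ℂ) ^ 2)⁻¹ * energy 𝔸 (iXfn χ w) (iXfn χ v) - z * mass (fn w) (fn v)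

variable {𝔸 χ z} {m s : ℤ} {w v : H1per}

theorem orderTerms_low (h : s = m + 2) : orderTerms 𝔸 χ z m s w v = lowTerm 𝔸 χ w v := by
  rw [orderTerms, if_pos (by omega), if_neg (by omega), if_neg (by omega), add_zero, add_zero,
    lowTerm]

theorem orderTerms_mid (h : s = m + 1) : orderTerms 𝔸 χ z m s w v = midTerm 𝔸 χ w v := by
  rw [orderTerms, if_neg (by omega), if_pos (by omega), if_neg (by omega), add_zero, zero_add,
    midTerm]

theorem orderTerms_top (h : s = m) : orderTerms 𝔸 χ z m s w v = topTerm 𝔸 χ z w v := by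
  rw [orderTerms, if_neg (by omega), if_neg (by omega), if_pos h, zero_add, zero_add, topTerm]

theorem orderTerms_eq_zero (h : s < m ∨ m + 2 < s) : orderTerms 𝔸 χ z m s w v = 0 := by
  rw [orderTerms, if_neg (by omega), if_neg (by omega), if_neg (by omega), add_zero, zero_add]

variable {f : L2Vec} {u : ℕ → Fin 3 → H1per}

theorem collect_zero (m : ℤ) (v : H1per) : collect 𝔸 χ z f u 0 m v =
    orderTerms 𝔸 χ z m 0 (u 0 0) v + orderTerms 𝔸 χ z m 1 (u 0 1) v +
      orderTerms 𝔸 χ z m 2 (u 0 2) v - (if m = 0 then mass f (fn v) else 0) := by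
  simp [collect, Fin.sum_univ_three]

theorem collect_succ (n : ℕ) (m : ℤ) (v : H1per) : collect 𝔸 χ z f u (n + 1) m v =
    collect 𝔸 χ z f u n m v + (orderTerms 𝔸 χ z m (n + 1) (u (n + 1) 0) v +
      orderTerms 𝔸 χ z m (n + 2) (u (n + 1) 1) v + orderTerms 𝔸 χ z m (n + 3) (u (n + 1) 2) v) := by
  rw [collect, collect, Finset.sum_range_succ, Fin.sum_univ_three]
  have e1 : ((((1 : Fin 3) : ℕ) : ℤ) + ((n + 1 : ℕ) : ℤ)) = n + 2 := by push_cast; ring_nf; rfl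
  have e2 : ((((2 : Fin 3) : ℕ) : ℤ) + ((n + 1 : ℕ) : ℤ)) = n + 3 := by push_cast; ring_nf; rfl
  have e0 : ((((0 : Fin 3) : ℕ) : ℤ) + ((n + 1 : ℕ) : ℤ)) = n + 1 := by push_cast; ring_nf; rfl
  rw [e0, e1, e2]
  ring

/-- The highest order present after cycle `n` is `n + 2`, reached by `u_2^{(n)}`. The free `k` is
needed in the induction, since lowering `n` by one raises `k` by one. -/
theorem collect_add_three (n k : ℕ) (v : H1per) :
    collect 𝔸 χ z f u n (n + 3 + k : ℤ) v = 0 := by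
  induction n generalizing k with
  | zero =>
    rw [collect_zero, orderTerms_eq_zero (by left; omega),
      orderTerms_eq_zero (by left; omega),
      orderTerms_eq_zero (by left; omega), if_neg (by omega)]
    ring
  | succ n ih =>
    rw [collect_succ, orderTerms_eq_zero (by left; omega),
      orderTerms_eq_zero (by left; omega),
      orderTerms_eq_zero (by left; omega)]
    have h := ih (k + 1)
    have e : ((n + 1 : ℕ) + 3 + k : ℤ) = n + 3 + (k + 1 : ℕ) := by push_cast; ring
    rw [e, h]
    ring

/-- Orders `n + 2`, `n + 1` and `n` of cycle `n` are computed in descending sequence: each comes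
from the next higher one of the preceding cycle, plus the contributions of the new terms. -/
theorem collect_add_two (n : ℕ) (v : H1per) :
    collect 𝔸 χ z f u n (n + 2 : ℤ) v = topTerm 𝔸 χ z (u n 2) v := by
  cases n with
  | zero =>
    rw [collect_zero, orderTerms_eq_zero (by left; omega),
      orderTerms_eq_zero (by left; omega), orderTerms_top (by omega),
      if_neg (by omega)]
    ring
  | succ n =>
    have e : ((n + 1 : ℕ) + 2 : ℤ) = n + 3 + (0 : ℕ) := by push_cast; ring
    rw [e, collect_succ, collect_add_three, orderTerms_eq_zero (by left; omega),
      orderTerms_eq_zero (by left; omega), orderTerms_top (by omega)]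
    ring

theorem topTerm_zero (v : H1per) : topTerm 𝔸 χ z 0 v = 0 := by
  have h : fn 0 =ᵐ[cellMeasure] (0 : (Fin 3 → ℝ) → Vec) := Lp.coeFn_zero _ _ _
  have hX : iXfn χ 0 =ᵐ[cellMeasure] 0 := by
    filter_upwards [h] with y hy
    rw [iXfn, hy]
    exact map_zero (iXL χ)
  have h1 : energy 𝔸 (iXfn χ 0) (iXfn χ v) = 0 := by
    refine integral_eq_zero_of_ae ?_
    filter_upwards [hX] with y hy
    simp [hy]
  have h2 : mass (fn 0) (fn v) = 0 := by
    refine integral_eq_zero_of_ae ?_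
    filter_upwards [h] with y hy
    simp [hy]
  rw [topTerm, h1, h2]
  ring

theorem midTerm_zero (v : H1per) : midTerm 𝔸 χ 0 v = 0 := by
  have h : fn 0 =ᵐ[cellMeasure] (0 : (Fin 3 → ℝ) → Vec) := Lp.coeFn_zero _ _ _
  have hX : iXfn χ 0 =ᵐ[cellMeasure] 0 := by
    filter_upwards [h] with y hy
    rw [iXfn, hy]
    exact map_zero (iXL χ)
  have hD : symGrad 0 =ᵐ[cellMeasure] 0 := by
    have h' : (0 : H1per).1.snd =ᵐ[cellMeasure] (0 : (Fin 3 → ℝ) → Mat) := Lp.coeFn_zero _ _ _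
    filter_upwards [h'] with y hy
    rw [symGrad, hy]
    exact map_zero symPartL
  have h1 : energy 𝔸 (iXfn χ 0) (symGrad v) = 0 := by
    refine integral_eq_zero_of_ae ?_
    filter_upwards [hX] with y hy
    simp [hy]
  have h2 : energy 𝔸 (symGrad 0) (iXfn χ v) = 0 := by
    refine integral_eq_zero_of_ae ?_
    filter_upwards [hD] with y hy
    simp [hy]
  rw [midTerm, h1, h2]
  ring

theorem collect_add_one (n : ℕ) (v : H1per) :
    collect 𝔸 χ z f u n (n + 1 : ℤ) v = midTerm 𝔸 χ (u n 2) v + topTerm 𝔸 χ z (u n 1) v +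
      topTerm 𝔸 χ z (delay (u · 2) n) v := by
  cases n with
  | zero =>
    rw [collect_zero, orderTerms_eq_zero (by left; omega),
      orderTerms_top (by omega), orderTerms_mid (by omega),
      if_neg (by omega), delay, topTerm_zero]
    ring
  | succ n =>
    have e : ((n + 1 : ℕ) + 1 : ℤ) = n + 2 := by push_cast; ring
    rw [e, collect_succ, collect_add_two, orderTerms_eq_zero (by left; omega),
      orderTerms_top (by omega), orderTerms_mid (by omega), delay]
    ring

/-- The delays insert zero for negative cycle indices, and `cycleLoad` records that `f` enters at
order zero only, so one formula covers all cycles. -/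
theorem collect_self (n : ℕ) (v : H1per) :
    collect 𝔸 χ z f u n n v = lowTerm 𝔸 χ (u n 2) v + midTerm 𝔸 χ (u n 1) v +
      midTerm 𝔸 χ (delay (u · 2) n) v + topTerm 𝔸 χ z (u n 0) v +
      topTerm 𝔸 χ z (delay (u · 1) n) v + topTerm 𝔸 χ z (delay (delay (u · 2)) n) v -
      mass (cycleLoad f n) (fn v) := by
  cases n with
  | zero =>
    rw [collect_zero, orderTerms_top (by omega), orderTerms_mid (by omega),
      orderTerms_low (by omega), if_pos (by omega)]
    simp only [delay, cycleLoad, topTerm_zero, midTerm_zero]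
    ring
  | succ n =>
    have hm : mass (0 : L2Vec) (fn v) = 0 := by
      refine integral_eq_zero_of_ae ?_
      filter_upwards [Lp.coeFn_zero Vec 2 cellMeasure] with y hy
      simp
    have e : ((n + 1 : ℕ) : ℤ) = n + 1 := by push_cast; ring
    rw [e, collect_succ, collect_add_one, orderTerms_top (by omega), orderTerms_mid (by omega),
      orderTerms_low (by omega)]
    simp only [delay, cycleLoad, hm]
    ring

theorem collect_zero_neg_two (v : H1per) :
    collect 𝔸 χ z f u 0 (-2) v = lowTerm 𝔸 χ (u 0 0) v := by
  rw [collect_zero, orderTerms_low (by norm_num), orderTerms_eq_zero (by norm_num),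
    orderTerms_eq_zero (by norm_num), if_neg (by norm_num)]
  ring

theorem collect_zero_neg_one (v : H1per) :
    collect 𝔸 χ z f u 0 (-1) v = midTerm 𝔸 χ (u 0 0) v + lowTerm 𝔸 χ (u 0 1) v := by
  rw [collect_zero, orderTerms_mid (by norm_num), orderTerms_low (by norm_num),
    orderTerms_eq_zero (by norm_num), if_neg (by norm_num)]
  ring

theorem collect_succ_self (n : ℕ) (v : H1per) : collect 𝔸 χ z f u (n + 1) n v =
    collect 𝔸 χ z f u n n v + (midTerm 𝔸 χ (u (n + 1) 0) v + lowTerm 𝔸 χ (u (n + 1) 1) v) := by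
  rw [collect_succ, orderTerms_mid (by omega), orderTerms_low (by omega),
    orderTerms_eq_zero (by omega), add_zero]

theorem collect_succ_pred (n : ℕ) (v : H1per) : collect 𝔸 χ z f u (n + 1) (n - 1) v =
    collect 𝔸 χ z f u n (n - 1) v + lowTerm 𝔸 χ (u (n + 1) 0) v := by
  rw [collect_succ, orderTerms_low (by omega), orderTerms_eq_zero (by omega),
    orderTerms_eq_zero (by omega), add_zero, add_zero]

/-- Subtracting the equations of the earlier cycles leaves one equation for each new term. -/
theorem isAsymptoticProcedure_iff : IsAsymptoticProcedure 𝔸 χ z f u ↔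
    ∀ n, mean (u n 1) = 0 ∧ mean (u n 2) = 0 ∧ ∀ v, lowTerm 𝔸 χ (u n 0) v = 0 ∧
      midTerm 𝔸 χ (u n 0) v + lowTerm 𝔸 χ (u n 1) v = 0 ∧ collect 𝔸 χ z f u n n v = 0 := by
  constructor
  · intro h n
    refine ⟨(h n).1, (h n).2.1, fun v => ?_⟩
    obtain ⟨h1, h2, h3⟩ := (h n).2.2 v
    cases n with
    | zero =>
      have e2 : ((0 : ℕ) : ℤ) - 2 = -2 := by norm_num
      have e1 : ((0 : ℕ) : ℤ) - 1 = -1 := by norm_num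
      rw [e2, collect_zero_neg_two] at h1
      rw [e1, collect_zero_neg_one] at h2
      exact ⟨h1, h2, h3⟩
    | succ n =>
      -- The equations of orders `n - 1` and `n` from cycle `n` are exactly the old parts of the two
      -- lowest equations of cycle `n + 1`.
      obtain ⟨-, h2', h3'⟩ := (h n).2.2 v
      have e2 : ((n + 1 : ℕ) : ℤ) - 2 = n - 1 := by push_cast; ring
      have e1 : ((n + 1 : ℕ) : ℤ) - 1 = n := by push_cast; ring
      rw [e2, collect_succ_pred, h2', zero_add] at h1
      rw [e1, collect_succ_self, h3', zero_add] at h2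
      exact ⟨h1, h2, h3⟩
  · intro h n
    refine ⟨(h n).1, (h n).2.1, fun v => ?_⟩
    -- This order is met again in the next cycle as its lowest one, so it is settled first for all
    -- cycles.
    have hpred : ∀ n : ℕ, collect 𝔸 χ z f u n ((n : ℤ) - 1) v = 0 := by
      intro n
      cases n with
      | zero =>
        have e1 : ((0 : ℕ) : ℤ) - 1 = -1 := by norm_num
        rw [e1, collect_zero_neg_one]
        exact ((h 0).2.2 v).2.1
      | succ n =>
        have e1 : ((n + 1 : ℕ) : ℤ) - 1 = n := by push_cast; ring
        rw [e1, collect_succ_self, ((h n).2.2 v).2.2, zero_add]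
        exact ((h (n + 1)).2.2 v).2.1
    refine ⟨?_, hpred n, ((h n).2.2 v).2.2⟩
    cases n with
    | zero =>
      have e2 : ((0 : ℕ) : ℤ) - 2 = -2 := by norm_num
      rw [e2, collect_zero_neg_two]
      exact ((h 0).2.2 v).1
    | succ n =>
      have e2 : ((n + 1 : ℕ) : ℤ) - 2 = n - 1 := by push_cast; ring
      rw [e2, collect_succ_pred, hpred, zero_add]
      exact ((h (n + 1)).2.2 v).1

end Orders

/-! ### The procedure as a recursion of cycle problems -/

variable {𝔸 : TensorField} (h𝔸 : IsElasticityTensor 𝔸) {χ : EuclideanSpace ℝ (Fin 3)} {z : ℂ}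
  {f : L2Vec} {u : ℕ → Fin 3 → H1per}

/-- The asymptotic procedure is equivalent to the sequence of cycle equations. -/
theorem isAsymptoticProcedure_iff_cycleEqs (hχ0 : χ ≠ 0) : IsAsymptoticProcedure 𝔸 χ z f u ↔
    ∀ n, (cellSystem h𝔸 χ).CycleEqs z ((‖χ‖ : ℂ) ^ 2) (cycleLoad f n) (delay (u · 1) n)
      (delay (u · 2) n) (delay (delay (u · 2)) n) (u n 0) (u n 1) (u n 2) := by
  have hn : (‖χ‖ : ℂ) ≠ 0 := by simpa using hχ0
  rw [isAsymptoticProcedure_iff]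
  refine forall_congr' fun n => ?_
  simp only [collect_self, lowTerm, midTerm, topTerm, energy_symGrad_symGrad h𝔸 χ,
    energy_iXfn_symGrad h𝔸, energy_symGrad_iXfn h𝔸, energy_iXfn_iXfn h𝔸, mass_fn h𝔸 χ,
    ← m_eq_mean h𝔸 χ]
  set P := cellSystem h𝔸 χ
  have hF : ∀ w, fn w = P.F w := fun _ => rfl
  simp only [hF]
  constructor
  · rintro ⟨h1, h2, h⟩
    have h0 : ∀ v, inner ℂ (P.D v) (P.M (P.D (u n 0))) = 0 := fun v => by
      simpa [hn] using (h v).1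
    -- The lowest equation makes `u_0` constant, which removes its strain from the equation for
    -- `u_1`.
    have hD : P.D (u n 0) = 0 := by rw [P.eq_K_of_form_eq_zero (h0 _), P.D_K]
    refine ⟨h0, fun v => ?_, h1, fun v => ?_, h2⟩
    · have h3 := (h v).2.1
      simp only [hD, map_zero, inner_zero_right, zero_add, ← mul_add] at h3
      have h4 := (mul_eq_zero.1 h3).resolve_left (by simpa using hn)
      linear_combination h4
    · have h3 := (h v).2.2
      field_simp at h3
      simp only [map_add, inner_add_right]
      linear_combination h3
  · rintro ⟨h0, h1, hm1, h2, hm2⟩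
    have hD : P.D (u n 0) = 0 := by rw [P.eq_K_of_form_eq_zero (h0 _), P.D_K]
    refine ⟨hm1, hm2, fun v => ⟨by rw [h0, mul_zero], ?_, ?_⟩⟩
    · rw [h1, hD, map_zero, inner_zero_right]
      ring
    · have h3 := h2 v
      simp only [map_add, inner_add_right] at h3
      field_simp
      linear_combination h3

theorem mean_zero : mean 0 = 0 := by rw [← meanL_apply, map_zero]

theorem mean_delay_eq_zero {x : ℕ → H1per} (h : ∀ n, mean (x n) = 0) (n : ℕ) :
    mean (delay x n) = 0 := by
  cases n with
  | zero => exact mean_zero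
  | succ n => exact h n

/-- The solution of the system of one cycle, in terms of an inverse `R` of
`|χ|⁻² 𝒜_χ^hom - z`. -/
def cycleSolution (χ : EuclideanSpace ℝ (Fin 3)) (z : ℂ) (R : Vec →L[ℂ] Vec) (g : L2Vec)
    (p q r : H1per) : Fin 3 → H1per :=
  let P := cellSystem h𝔸 χ
  let c := P.leading ((‖χ‖ : ℂ) ^ 2) R (g, p, q, r)
  ![P.K c, P.cor c, P.S (P.load z ((‖χ‖ : ℂ) ^ 2) R (g, p, q, r))]

theorem eq_cons_three_iff {W : Type*} {w : Fin 3 → W} {a b c : W} :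
    w = ![a, b, c] ↔ w 0 = a ∧ w 1 = b ∧ w 2 = c := by
  constructor
  · rintro rfl
    exact ⟨rfl, rfl, rfl⟩
  · rintro ⟨rfl, rfl, rfl⟩
    funext j
    fin_cases j <;> rfl

variable {R : Vec →L[ℂ] Vec}

theorem cycleProblem_iff_eq (hχ0 : χ ≠ 0) (hR : ∀ a b, R a = b ↔
      ((‖χ‖ : ℂ) ^ 2)⁻¹ • (cellSystem h𝔸 χ).hom b - z • b = a) {g : L2Vec} {p q r : H1per}
    (hp : mean p = 0) (hr : mean r = 0) {w : Fin 3 → H1per} :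
    CycleProblem 𝔸 χ z g p q r w ↔ w = cycleSolution h𝔸 χ z R g p q r := by
  have hs : ((‖χ‖ : ℂ) ^ 2) ≠ 0 := by simpa using hχ0
  rw [cycleProblem_iff h𝔸, CellSystem.cycle_iff hR hs (by rwa [m_eq_mean]) (by rwa [m_eq_mean]),
    cycleSolution, eq_cons_three_iff]

theorem IsAsymptoticProcedure.mean_eq_zero (h : IsAsymptoticProcedure 𝔸 χ z f u) (n : ℕ) :
    mean (delay (u · 1) n) = 0 ∧ mean (delay (delay (u · 2)) n) = 0 :=
  ⟨mean_delay_eq_zero (fun n => (h n).1) n,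
    mean_delay_eq_zero (mean_delay_eq_zero fun n => (h n).2.1) n⟩

theorem isAsymptoticProcedure_iff_eq_cycleSolution (hχ0 : χ ≠ 0) (hR : ∀ a b, R a = b ↔
      ((‖χ‖ : ℂ) ^ 2)⁻¹ • (cellSystem h𝔸 χ).hom b - z • b = a) :
    IsAsymptoticProcedure 𝔸 χ z f u ↔ ∀ n, u n = cycleSolution h𝔸 χ z R (cycleLoad f n)
      (delay (u · 1) n) (delay (u · 2) n) (delay (delay (u · 2)) n) := by
  have hs : ((‖χ‖ : ℂ) ^ 2) ≠ 0 := by simpa using hχ0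
  constructor
  · intro h n
    obtain ⟨hp, hr⟩ := h.mean_eq_zero n
    rw [← cycleProblem_iff_eq h𝔸 hχ0 hR hp hr, cycleProblem_iff h𝔸]
    have h1 := (isAsymptoticProcedure_iff_cycleEqs h𝔸 hχ0).1 h n
    exact ⟨h1, h1.homEq hs (by rwa [m_eq_mean]) (by rwa [m_eq_mean])⟩
  · intro h
    -- Solving a cycle requires data `p` and `r` of mean zero. These come from earlier cycles, whose
    -- means are known only once those are solved; hence strong induction.
    have hm : ∀ n, (mean (u n 1) = 0 ∧ mean (u n 2) = 0) ∧
        (cellSystem h𝔸 χ).CycleEqs z ((‖χ‖ : ℂ) ^ 2) (cycleLoad f n) (delay (u · 1) n)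
          (delay (u · 2) n) (delay (delay (u · 2)) n) (u n 0) (u n 1) (u n 2) := by
      intro n
      induction n using Nat.strong_induction_on with
      | _ n ih =>
        have hp : mean (delay (u · 1) n) = 0 := by
          rcases n with _ | n
          · exact mean_zero
          · exact (ih n (by omega)).1.1
        have hr : mean (delay (delay (u · 2)) n) = 0 := by
          rcases n with _ | _ | n
          · exact mean_zero
          · exact mean_zero
          · exact (ih n (by omega)).1.2
        have h1 := (cycleProblem_iff_eq h𝔸 hχ0 hR hp hr).2 (h n)
        exact ⟨⟨h1.mean_one, h1.mean_two⟩, ((cycleProblem_iff h𝔸 χ).1 h1).1⟩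
    exact (isAsymptoticProcedure_iff_cycleEqs h𝔸 hχ0).2 fun n => (hm n).2

/-- The successive terms of the expansion, together with the term `u_2` of the previous cycle. -/
def expansion (χ : EuclideanSpace ℝ (Fin 3)) (z : ℂ) (R : Vec →L[ℂ] Vec) (f : L2Vec) :
    ℕ → (Fin 3 → H1per) × H1per
  | 0 => (cycleSolution h𝔸 χ z R f 0 0 0, 0)
  | n + 1 => (cycleSolution h𝔸 χ z R 0 ((expansion χ z R f n).1 1) ((expansion χ z R f n).1 2)
      (expansion χ z R f n).2, (expansion χ z R f n).1 2)

theorem existsUnique_isAsymptoticProcedure (hχ0 : χ ≠ 0) (hR : ∀ a b, R a = b ↔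
      ((‖χ‖ : ℂ) ^ 2)⁻¹ • (cellSystem h𝔸 χ).hom b - z • b = a) (f : L2Vec) :
    ∃! u, IsAsymptoticProcedure 𝔸 χ z f u := by
  simp only [isAsymptoticProcedure_iff_eq_cycleSolution h𝔸 hχ0 hR]
  have key : ∀ u u' : ℕ → Fin 3 → H1per,
      (∀ n, u n = cycleSolution h𝔸 χ z R (cycleLoad f n)
        (delay (u · 1) n) (delay (u · 2) n) (delay (delay (u · 2)) n)) →
      (∀ n, u' n = cycleSolution h𝔸 χ z R (cycleLoad f n)
        (delay (u' · 1) n) (delay (u' · 2) n) (delay (delay (u' · 2)) n)) → u = u' := by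
    intro u u' h h'
    funext n
    induction n using Nat.strong_induction_on with
    | _ n ih =>
      rw [h, h', delay_congr fun k hk => congrFun (ih k hk) 1,
        delay_congr fun k hk => congrFun (ih k hk) 2,
        delay_congr fun k hk => delay_congr fun l hl => congrFun (ih l (hl.trans hk)) 2]
  have hdelay : ∀ n, (expansion h𝔸 χ z R f n).2 =
      delay (fun n => (expansion h𝔸 χ z R f n).1 2) n := fun n => by
    cases n <;> simp only [expansion, delay]
  have hex : ∀ n, (expansion h𝔸 χ z R f n).1 = cycleSolution h𝔸 χ z R (cycleLoad f n)
      (delay (fun n => (expansion h𝔸 χ z R f n).1 1) n)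
      (delay (fun n => (expansion h𝔸 χ z R f n).1 2) n)
      (delay (delay fun n => (expansion h𝔸 χ z R f n).1 2) n) := fun n => by
    cases n with
    | zero => simp only [expansion, delay, cycleLoad]
    | succ n =>
      rw [expansion, hdelay]
      simp only [delay, cycleLoad]
  exact ⟨fun n => (expansion h𝔸 χ z R f n).1, hex, fun u hu => key _ _ hu hex⟩

/-! ### The error term -/

theorem solvesResolventProblem_iff {F : H1per → ℂ} {U : H1per} :
    SolvesResolventProblem 𝔸 χ z F U ↔ ∀ v, ((‖χ‖ : ℂ) ^ 2)⁻¹ *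
      ⟪(cellSystem h𝔸 χ).D v + (cellSystem h𝔸 χ).X v,
        (cellSystem h𝔸 χ).M ((cellSystem h𝔸 χ).D U + (cellSystem h𝔸 χ).X U)⟫ -
      z * ⟪(cellSystem h𝔸 χ).F v, (cellSystem h𝔸 χ).F U⟫ = F v := by
  simp only [SolvesResolventProblem, fiberForm_eq_inner h𝔸, mass_fn h𝔸 χ]
  rfl

theorem residual_eq (q w₁ w₂ v : H1per) : residual 𝔸 χ z q w₁ w₂ v =
    (cellSystem h𝔸 χ).residual z ((‖χ‖ : ℂ) ^ 2) q w₁ w₂ v := by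
  simp only [residual, CellSystem.residual, energy_iXfn_symGrad h𝔸, energy_symGrad_iXfn h𝔸,
    energy_iXfn_iXfn h𝔸, mass_fn h𝔸 χ]
  rfl

-- Induction on the cycle. Before cycle 0 the error is `U` itself, its residual vanishes and the
-- load is `f`; afterwards the load is zero and the residual of the preceding cycle takes its place.
include h𝔸 in
theorem solves_errorTerm (hχ0 : χ ≠ 0) (h : IsAsymptoticProcedure 𝔸 χ z f u) {U : H1per}
    (hU : SolvesResolventProblem 𝔸 χ z (fun v => mass f (fn v)) U) (n : ℕ) :
    SolvesResolventProblem 𝔸 χ z (fun v => ((‖χ‖ : ℂ) ^ 2)⁻¹ *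
      residual 𝔸 χ z (delay (u · 2) n) (u n 1) (u n 2) v) (errorTerm U u n) := by
  have hs : ((‖χ‖ : ℂ) ^ 2) ≠ 0 := by simpa using hχ0
  have hc := (isAsymptoticProcedure_iff_cycleEqs h𝔸 hχ0).1 h
  simp only [residual_eq h𝔸, solvesResolventProblem_iff h𝔸, mass_fn h𝔸 χ] at hU ⊢
  induction n with
  | zero =>
    have e : errorTerm U u 0 = U - (u 0 0 + u 0 1 + u 0 2) := by simp [errorTerm]
    rw [e]
    refine (hc 0).residual_step hs fun v => ?_
    rw [hU]
    simp [CellSystem.residual, delay, cycleLoad]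
  | succ n ih =>
    have e : errorTerm U u (n + 1) =
        errorTerm U u n - (u (n + 1) 0 + u (n + 1) 1 + u (n + 1) 2) := by
      rw [errorTerm, errorTerm, Finset.sum_range_succ _ (n + 1), sub_sub]
    rw [e]
    refine (hc (n + 1)).residual_step hs fun v => ?_
    rw [ih]
    simp [delay, cycleLoad]

/-! ### The resolvent problem -/

-- Existence holds because `R f` lies in the domain of the operator. The resolvent determines only
-- the underlying `L²` function, whereas an element of `H¹_#` also carries a gradient. For the
-- difference of two solutions the function vanishes, hence so do its mean and `X`; testing with the
-- difference leaves zero elastic energy, and coercivity removes the gradient.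
include h𝔸 in
theorem existsUnique_solvesResolventProblem (hχ0 : χ ≠ 0) (hz : z ∈ fiberResolventSet 𝔸 χ)
    (f : L2Vec) :
    ∃! U : H1per, SolvesResolventProblem 𝔸 χ z (fun v => mass f (fn v)) U := by
  have hn : (‖χ‖ : ℂ) ≠ 0 := by simpa using hχ0
  have hs : ((‖χ‖ : ℂ) ^ 2) ≠ 0 := by simpa using hχ0
  obtain ⟨R, hR⟩ := hz
  have hfn : ∀ U, SolvesResolventProblem 𝔸 χ z (fun v => mass f (fn v)) U → R f = fn U := by
    intro U hU
    -- The value of `𝒜_χ` at the solution is read off from the equation: `|χ|² (f + z u)`.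
    refine (hR f (fn U)).2 ⟨((‖χ‖ : ℂ) ^ 2) • (f + z • fn U), ⟨U, rfl, fun v => ?_⟩, ?_⟩
    · have h := hU v
      simp only [mass_fn h𝔸 χ] at h ⊢
      rw [inner_smul_right, inner_add_right, inner_smul_right, ← h]
      field_simp
      ring_nf
    · rw [inv_smul_smul₀ hs, add_sub_cancel_right]
  obtain ⟨g, ⟨U, hU, hg⟩, hf⟩ := (hR f (R f)).1 rfl
  have hU' : SolvesResolventProblem 𝔸 χ z (fun v => mass f (fn v)) U := fun v => by
    have h := hg v
    simp only [mass_fn h𝔸 χ] at h ⊢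
    rw [h, hU, ← inner_smul_right, ← inner_smul_right, ← inner_sub_right, hf]
  refine ⟨U, hU', fun V hV => ?_⟩
  beta_reduce at hV
  have hVU : fn V = fn U := (hfn V hV).symm.trans (hfn U hU')
  rw [solvesResolventProblem_iff h𝔸] at hV hU'
  rw [← sub_eq_zero]
  set P := cellSystem h𝔸 χ
  have hF : P.F (V - U) = 0 := by
    rw [map_sub, sub_eq_zero]
    exact hVU
  have hX : P.X (V - U) = 0 := by
    change (iXL χ).compLpL 2 cellMeasure (P.F (V - U)) = 0
    rw [hF, map_zero]
  have hm : P.m (V - U) = 0 := by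
    refine ext_inner_left ℂ fun a => ?_
    rw [← P.inner_F_K, hF, inner_zero_right, inner_zero_right]
  refine P.eq_zero_of_form_eq_zero hm ?_
  have h1 := (hV (V - U)).trans (hU' (V - U)).symm
  rw [hF, hX, inner_zero_left, inner_zero_left, add_zero] at h1
  have h2 : ⟪P.D (V - U), P.M (P.D V + P.X V)⟫ = ⟪P.D (V - U), P.M (P.D U + P.X U)⟫ := by
    simpa [hs] using h1
  have h3 : P.X V = P.X U := by rw [← sub_eq_zero, ← map_sub, hX]
  rw [h3, map_add, map_add, inner_add_right, inner_add_right, add_left_inj] at h2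
  rw [map_sub P.D V U, map_sub P.M, inner_sub_right, ← map_sub P.D V U, h2, sub_self]

end Elasticity
end

open Elasticity in
theorem mainTheorem3 (𝔸 : TensorField) (h𝔸 : IsElasticityTensor 𝔸)
    (χ : EuclideanSpace ℝ (Fin 3)) (hχ : χ ∈ dualCell) (hχ0 : χ ≠ 0) (z : ℂ)
    (hz : z ∈ resolventSet ℂ (((‖χ‖ : ℂ) ^ 2)⁻¹ • homMatrix 𝔸 χ)) :
    -- the homogenized matrix is well defined by the corrector problems
    (∀ c : Vec, (∀ w : H1per, IsCorrector 𝔸 χ c w ↔ w = corrector 𝔸 χ c) ∧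
      ∀ d : Vec, homPairing 𝔸 χ c d = homForm 𝔸 χ c d) ∧
    -- the system of every cycle is well posed
    (∀ (g : L2Vec) (p q r : H1per), mean p = 0 → mean r = 0 →
      ∃! w : Fin 3 → H1per, CycleProblem 𝔸 χ z g p q r w) ∧
    (∃ C : ℝ, ∀ (g : L2Vec) (p q r : H1per) (w : Fin 3 → H1per), mean p = 0 → mean r = 0 →
      CycleProblem 𝔸 χ z g p q r w → ∀ j, ‖w j‖ ≤ C * (‖g‖ + ‖p‖ + ‖q‖ + ‖r‖)) ∧
    -- the resolvent problem is uniquely solvable on the resolvent set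
    (z ∈ fiberResolventSet 𝔸 χ → ∀ f : L2Vec,
      ∃! U : H1per, SolvesResolventProblem 𝔸 χ z (fun v => mass f (fn v)) U) ∧
    -- the asymptotic procedure determines its terms, which are given by the cycle problems
    ∀ f : L2Vec, (∃! u : ℕ → Fin 3 → H1per, IsAsymptoticProcedure 𝔸 χ z f u) ∧
      ∀ u : ℕ → Fin 3 → H1per, IsAsymptoticProcedure 𝔸 χ z f u →
        (∀ n, ∃ c : Vec, fn (u n 0) =ᵐ[cellMeasure] fun _ => c) ∧
        (∀ w, CycleProblem 𝔸 χ z f 0 0 0 w ↔ w = u 0) ∧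
        (∀ w, CycleProblem 𝔸 χ z 0 (u 0 1) (u 0 2) 0 w ↔ w = u 1) ∧
        (∀ n w, CycleProblem 𝔸 χ z 0 (u (n + 1) 1) (u (n + 1) 2) (u n 2) w ↔ w = u (n + 2)) ∧
        -- the equation for the error term
        ∀ U : H1per, SolvesResolventProblem 𝔸 χ z (fun v => mass f (fn v)) U →
          SolvesResolventProblem 𝔸 χ z
            (fun v => ((‖χ‖ : ℂ) ^ 2)⁻¹ * residual 𝔸 χ z 0 (u 0 1) (u 0 2) v)
            (errorTerm U u 0) ∧
          ∀ n, SolvesResolventProblem 𝔸 χ z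
            (fun v => ((‖χ‖ : ℂ) ^ 2)⁻¹ *
              residual 𝔸 χ z (u n 2) (u (n + 1) 1) (u (n + 1) 2) v)
            (errorTerm U u (n + 1)) := by
  have hs : ((‖χ‖ : ℂ) ^ 2) ≠ 0 := by simpa using hχ0
  obtain ⟨R, hR⟩ := exists_resolvent h𝔸 hz
  have hcyc : ∀ {g : L2Vec} {p q r : H1per} {w : Fin 3 → H1per}, mean p = 0 → mean r = 0 →
      (CycleProblem 𝔸 χ z g p q r w ↔ w = cycleSolution h𝔸 χ z R g p q r) :=
    fun hp hr => cycleProblem_iff_eq h𝔸 hχ0 hR hp hr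
  refine ⟨fun c => ⟨fun w => ?_, fun d => ?_⟩, fun g p q r hp hr => ?_, ?_,
    fun hz' f => existsUnique_solvesResolventProblem h𝔸 hχ0 hz' f, fun f =>
    ⟨existsUnique_isAsymptoticProcedure h𝔸 hχ0 hR f, fun u hu => ?_⟩⟩
  · rw [isCorrector_iff h𝔸, corrector_eq h𝔸]
  · rw [homPairing_eq_inner h𝔸, homForm_eq_inner h𝔸]
  · exact ⟨_, (hcyc hp hr).2 rfl, fun w hw => (hcyc hp hr).1 hw⟩
  · obtain ⟨B, hB⟩ := CellSystem.cycle_bound hR hs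
    refine ⟨B, fun g p q r w hp hr hw j => ?_⟩
    obtain ⟨h1, h2⟩ := (cycleProblem_iff h𝔸 χ).1 hw
    obtain ⟨b0, b1, b2⟩ := hB g p q r _ _ _ (by rwa [m_eq_mean]) (by rwa [m_eq_mean]) h1 h2
    fin_cases j
    · exact b0
    · exact b1
    · exact b2
  · have hsol := (isAsymptoticProcedure_iff_eq_cycleSolution h𝔸 hχ0 hR).1 hu
    have hall : ∀ n w, CycleProblem 𝔸 χ z (cycleLoad f n) (delay (u · 1) n) (delay (u · 2) n)
        (delay (delay (u · 2)) n) w ↔ w = u n := fun n w => by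
      obtain ⟨hp, hr⟩ := hu.mean_eq_zero n
      rw [hcyc hp hr, ← hsol]
    refine ⟨fun n => ⟨mean (u n 0), ?_⟩, hall 0, hall 1, fun n => hall (n + 2), fun U hU =>
      ⟨solves_errorTerm h𝔸 hχ0 hu hU 0, fun n => solves_errorTerm h𝔸 hχ0 hu hU (n + 1)⟩⟩
    have h0 := ((isAsymptoticProcedure_iff_cycleEqs h𝔸 hχ0).1 hu n).eq_K
    rw [m_eq_mean] at h0
    rw [congrArg fn h0]
    exact Lp.coeFn_const 2 cellMeasure _
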